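/- Let $P$ be a finite-dimensional $C^\infty$ manifold (Hausdorff, second countable, without boundary), and let $F:P\to\mathbb{R}$ be a $C^\infty$ function whose critical points are all contained in some codimension-$1$ embedded (not necessarily closed, possibly empty) submanifold $Z$ of $P$. Let $\mathfrak{X}^\infty(P)$ be the space of $C^\infty$ vector fields on $P$, with the strong (Whitney) $C^\infty$ topology, i.e. the relative topology as a subset of $C^\infty(P,TP)$. Here the strong topology on $C^\infty(M,N)$ is the one generated by the sets $$\Big\{g : g(K_i)\subset V_i,\ \big\|D^k(\psi_i\circ g\circ\varphi_i^{-1})(\varphi_i(x))-D^k(\psi_i\circ f\circ\varphi_i^{-1})(\varphi_i(x))\big\|<\varepsilon_i\ \text{ for all } i\in\Lambda,\ x\in K_i,\ 0\le k\le r\Big\},$$ where $f\in C^\infty(M,N)$, $r\in\mathbb{N}$, $(\varphi_i,U_i)_{i\in\Lambda}$ is a locally finite family of smooth charts of $M$, $K_i\subset U_i$ is compact, $(\psi_i,V_i)$ is a smooth chart of $N$ with $f(K_i)\subset V_i$, and $\varepsilon_i>0$. A subset of a topological space is residual if it contains a countable intersection of open dense subsets. Then there exists a residual subset $\mathcal{C}$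 of $\mathfrak{X}^\infty(P)$ such that every $X\in\mathcal{C}$ has the following two properties: 1. $X$ has no non-equilibrium solution along which $F$ is constant; that is, there are no open interval $J\subset\mathbb{R}$ and integral curve $\gamma:J\to P$ of $X$ such that $F\circ\gamma$ is constant and $X(\gamma(t))\neq 0$ for some $t\in J$. 2. The equilibria of $X$ are isolated: every $p\in P$ with $X(p)=0$ has a neighbourhood in which $p$ is the only zero of $X$. -/

import Mathlib

open scoped Manifold ContDiff Topology

noncomputable section

universe u

/-- A subset `Z` of a manifold `M` modelled on `E` is an (embedded) submanifold of codimension `k`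
if around each of its points there is a smooth chart of `M` in which `Z` is given by a linear
subspace of codimension `k`. The empty set is allowed. -/
def IsSubmanifoldOfCodim {E : Type*} [NormedAddCommGroup E] [NormedSpace ℝ E]
    {M : Type*} [TopologicalSpace M] [ChartedSpace E M] (k : ℕ) (Z : Set M) : Prop :=
  ∀ p ∈ Z, ∃ φ ∈ IsManifold.maximalAtlas 𝓘(ℝ, E) ∞ M, ∃ W : Submodule ℝ E,
    Module.finrank ℝ W + k = Module.finrank ℝ E ∧ p ∈ φ.source ∧
      ∀ x ∈ φ.source, x ∈ Z ↔ φ x ∈ W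

section StrongTopology

variable {E : Type*} [NormedAddCommGroup E] [NormedSpace ℝ E]
  {M : Type u} [TopologicalSpace M] [ChartedSpace E M]
  {E' : Type*} [NormedAddCommGroup E'] [NormedSpace ℝ E']
  {H' : Type*} [TopologicalSpace H'] {I' : ModelWithCorners ℝ E' H'}
  {N : Type*} [TopologicalSpace N] [ChartedSpace H' N]

/-- The set of all smooth `g : M → N` which map each `K i` into the domain of the chart `ψ i`,
and whose representatives in the charts `φ i`, `ψ i` have all derivatives of order `≤ r` within
`ε i` of those of `f`, at all points of `K i`. -/
def strongBasicSet (f : C^∞⟮𝓘(ℝ, E), M; I', N⟯) (r : ℕ) {ι : Type*}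
    (φ : ι → OpenPartialHomeomorph M E) (ψ : ι → OpenPartialHomeomorph N H')
    (K : ι → Set M) (ε : ι → ℝ) : Set C^∞⟮𝓘(ℝ, E), M; I', N⟯ :=
  {g | ∀ i, Set.MapsTo g (K i) (ψ i).source ∧ ∀ x ∈ K i, ∀ k ≤ r,
    ‖iteratedFDeriv ℝ k ((ψ i).extend I' ∘ g ∘ (φ i).symm) (φ i x)
      - iteratedFDeriv ℝ k ((ψ i).extend I' ∘ f ∘ (φ i).symm) (φ i x)‖ < ε i}

/-- The strong (Whitney) topology on `C^∞(M, N)`: it is generated by the sets `strongBasicSet`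
in which `r` is any finite order, `φ` is a family of smooth charts of `M` with locally finite
domains, `K i` is a compact subset of the domain of `φ i`, `f` maps `K i` into the domain of the
smooth chart `ψ i` of `N`, and the `ε i` are positive. -/
@[reducible] def strongTopology : TopologicalSpace C^∞⟮𝓘(ℝ, E), M; I', N⟯ :=
  TopologicalSpace.generateFrom
    {U | ∃ (f : C^∞⟮𝓘(ℝ, E), M; I', N⟯) (r : ℕ) (ι : Type u)
      (φ : ι → OpenPartialHomeomorph M E) (ψ : ι → OpenPartialHomeomorph N H')
      (K : ι → Set M) (ε : ι → ℝ),
      (∀ i, φ i ∈ IsManifold.maximalAtlas 𝓘(ℝ, E) ∞ M) ∧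
      (∀ i, ψ i ∈ IsManifold.maximalAtlas I' ∞ N) ∧
      LocallyFinite (fun i => (φ i).source) ∧
      (∀ i, IsCompact (K i) ∧ K i ⊆ (φ i).source ∧ Set.MapsTo f (K i) (ψ i).source) ∧
      (∀ i, 0 < ε i) ∧
      U = strongBasicSet f r φ ψ K ε}

end StrongTopology

/-- The smooth vector fields on `M`. -/
abbrev SmoothVectorField (E : Type*) [NormedAddCommGroup E] [NormedSpace ℝ E]
    (M : Type*) [TopologicalSpace M] [ChartedSpace E M] [IsManifold 𝓘(ℝ, E) ∞ M] : Type _ :=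
  Cₛ^∞⟮𝓘(ℝ, E); E, (TangentSpace 𝓘(ℝ, E) : M → Type _)⟯

/-- A smooth vector field, seen as a smooth map from the manifold to its tangent bundle. -/
def SmoothVectorField.toMap {E : Type*} [NormedAddCommGroup E] [NormedSpace ℝ E]
    {M : Type*} [TopologicalSpace M] [ChartedSpace E M] [IsManifold 𝓘(ℝ, E) ∞ M]
    (X : SmoothVectorField E M) :
    C^∞⟮𝓘(ℝ, E), M; 𝓘(ℝ, E).tangent, TangentBundle 𝓘(ℝ, E) M⟯ :=
  ⟨fun p => ⟨p, X p⟩, X.contMDiff⟩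

/-- The strong (Whitney) topology on the smooth vector fields: the relative topology as a subset
of `C^∞(M, TM)`. -/
instance SmoothVectorField.instTopologicalSpace {E : Type*} [NormedAddCommGroup E]
    [NormedSpace ℝ E] {M : Type*} [TopologicalSpace M] [ChartedSpace E M]
    [IsManifold 𝓘(ℝ, E) ∞ M] : TopologicalSpace (SmoothVectorField E M) :=
  TopologicalSpace.induced SmoothVectorField.toMap strongTopology

end

/-! Everything is local and generic. Suppose dg ≠ 0 near a point and an integral curve of X runs
inside a level set of g. Choose a field N with dg(N) = 1 and split X = T + h N with h = dg(X). Along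
the curve h = 0 and the velocity is T, so every iterated derivative of h along T vanishes there. For
j = 0, ..., n these are n + 1 equations on a space of dimension n, so for a generic X they should
have no common solution where T ≠ 0.

Density comes from replacing X by X + p(y) N, where y is a linear coordinate with y(T) ≠ 0 and p is
a polynomial of degree at most n. This leaves T unchanged and replaces h by h + p(y). Once T is
rescaled to have y-speed 1, the j-th derivative of p(y) is p^(j)(y), so a solution at x determines p
from x. The bad polynomials thus form a C¹ image of an n-dimensional set in ℝ^(n+1), and their
complement is dense (`dense_perturbation`, `dense_not_isHighlyTangent`). Openness holds because over
a compact set the equations are closed conditions on finite jets (`isOpen_not_isHighlyTangent`).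

Countably many such conditions give `exists_residual_not_tangent`. It is used with g = F near
regular points of F, and with g a local defining function of Z near points of Z. If F is constant
along a curve through a non-equilibrium, the first use confines the curve locally to the critical
set, hence to Z, and the second forbids this. Isolated equilibria follow from Sard's theorem:
generically all zeros of X are nondegenerate. -/

/-! ### Iterated Lie derivatives and jets -/

section Jets

variable {E W : Type*} [NormedAddCommGroup E] [NormedSpace ℝ E]
  [NormedAddCommGroup W] [NormedSpace ℝ W]

/-- The space of jets of order `r` of maps `E → W` (without base point). -/
abbrev JetSpace (r : ℕ) (E W : Type*) [NormedAddCommGroup E] [NormedSpace ℝ E]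
    [NormedAddCommGroup W] [NormedSpace ℝ W] : Type _ :=
  (k : Fin (r + 1)) → ContinuousMultilinearMap ℝ (fun _ : Fin (k : ℕ) => E) W

/-- The jet of order `r` of a map `u` at a point `x`. -/
noncomputable def jet (r : ℕ) (u : E → W) (x : E) : JetSpace r E W :=
  fun k => iteratedFDeriv ℝ k u x

/-- The iterated derivatives of a function `h` in the direction of a vector field `Y`. -/
noncomputable def iterLie (Y : E → E) (h : E → ℝ) : ℕ → E → ℝ
  | 0 => h
  | j + 1 => fun x => fderiv ℝ (iterLie Y h j) x (Y x)

theorem iterLie_contDiffOn {Y : E → E} {h : E → ℝ} {B : Set E} (hB : IsOpen B)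
    (hY : ContDiffOn ℝ ∞ Y B) (hh : ContDiffOn ℝ ∞ h B) (j : ℕ) :
    ContDiffOn ℝ ∞ (iterLie Y h j) B := by
  induction j with
  | zero => exact hh
  | succ j ih => exact (ih.fderiv_of_isOpen hB (by simp)).clm_apply hY

theorem iterLie_congr {Y Y' : E → E} {h h' : E → ℝ} {B : Set E} (hB : IsOpen B)
    (hY : Set.EqOn Y Y' B) (hh : Set.EqOn h h' B) (j : ℕ) :
    Set.EqOn (iterLie Y h j) (iterLie Y' h' j) B := by
  induction j with
  | zero => exact hh
  | succ j ih =>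
    intro x hx
    have : iterLie Y h j =ᶠ[𝓝 x] iterLie Y' h' j :=
      Filter.eventuallyEq_of_mem (hB.mem_nhds hx) ih
    simp only [iterLie]
    rw [this.fderiv_eq, hY hx]

theorem iterLie_add {Y : E → E} {h g : E → ℝ} {B : Set E} (hB : IsOpen B)
    (hY : ContDiffOn ℝ ∞ Y B) (hh : ContDiffOn ℝ ∞ h B) (hg : ContDiffOn ℝ ∞ g B) (j : ℕ) :
    Set.EqOn (iterLie Y (h + g) j) (iterLie Y h j + iterLie Y g j) B := by
  induction j with
  | zero => exact fun x _ => rfl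
  | succ j ih =>
    intro x hx
    have h1 : iterLie Y (h + g) j =ᶠ[𝓝 x] iterLie Y h j + iterLie Y g j :=
      Filter.eventuallyEq_of_mem (hB.mem_nhds hx) ih
    have d (f : E → ℝ) (hf : ContDiffOn ℝ ∞ f B) : DifferentiableAt ℝ (iterLie Y f j) x :=
      ((iterLie_contDiffOn hB hY hf j).contDiffAt (hB.mem_nhds hx)).differentiableAt (by simp)
    simp only [iterLie, Pi.add_apply]
    rw [h1.fderiv_eq, fderiv_add (d h hh) (d g hg)]
    rfl

/-- Iterated derivatives along a vector field of unit speed of a polynomial in a coordinate. -/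
theorem iterLie_polynomial {Y : E → E} {y : E →L[ℝ] ℝ} {B : Set E} (hB : IsOpen B)
    (hy : ∀ x ∈ B, y (Y x) = 1) (p : Polynomial ℝ) (j : ℕ) :
    Set.EqOn (iterLie Y (fun x => p.eval (y x)) j)
      (fun x => (Polynomial.derivative^[j] p).eval (y x)) B := by
  induction j with
  | zero => exact fun x _ => rfl
  | succ j ih =>
    intro x hx
    have h1 : iterLie Y (fun x => p.eval (y x)) j =ᶠ[𝓝 x]
        (fun x => (Polynomial.derivative^[j] p).eval (y x)) :=
      Filter.eventuallyEq_of_mem (hB.mem_nhds hx) ih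
    have h2 : HasFDerivAt (fun x => (Polynomial.derivative^[j] p).eval (y x))
        ((Polynomial.derivative (Polynomial.derivative^[j] p)).eval (y x) • y) x :=
      ((Polynomial.derivative^[j] p).hasDerivAt (y x)).comp_hasFDerivAt x y.hasFDerivAt
    simp only [iterLie]
    rw [h1.fderiv_eq, h2.fderiv, Function.iterate_succ_apply']
    simp [hy x hx]

theorem contDiff_jetSpace_apply (r : ℕ) (k : Fin (r + 1)) :
    ContDiff ℝ ∞ (fun J : JetSpace r E W => J k) :=
  (ContinuousLinearMap.proj (R := ℝ)
    (φ := fun k : Fin (r + 1) => ContinuousMultilinearMap ℝ (fun _ : Fin (k : ℕ) => E) W)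
    k).contDiff

theorem contDiff_jetSpace_value (r : ℕ) :
    ContDiff ℝ ∞ (fun J : JetSpace r E W => J ⟨0, r.succ_pos⟩ 0) :=
  ((ContinuousMultilinearMap.apply ℝ (fun _ : Fin 0 => E) W 0).contDiff).comp
    (contDiff_jetSpace_apply r ⟨0, r.succ_pos⟩)

theorem hasFDerivAt_jet {u : E → W} {x : E} (hu : ContDiffAt ℝ ∞ u x) (r : ℕ) :
    HasFDerivAt (jet r u)
      (ContinuousLinearMap.pi fun k : Fin (r + 1) => fderiv ℝ (iteratedFDeriv ℝ k u) x) x := by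
  rw [hasFDerivAt_pi]
  intro k
  exact (hu.differentiableAt_iteratedFDeriv (by exact_mod_cast ENat.natCast_lt_top _)).hasFDerivAt

/-- Iterated Lie derivatives are smooth functions of the jets. -/
theorem exists_iterLie_eq_jet {H : W → ℝ} {V : W → E} (hH : ContDiff ℝ ∞ H)
    (hV : ContDiff ℝ ∞ V) (j : ℕ) :
    ∃ Ψ : JetSpace j E W → ℝ, ContDiff ℝ ∞ Ψ ∧ ∀ (u : E → W) (B : Set E), IsOpen B →
      ContDiffOn ℝ ∞ u B → ∀ x ∈ B, iterLie (V ∘ u) (H ∘ u) j x = Ψ (jet j u x) := by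
  induction j with
  | zero =>
    refine ⟨fun J => H (J 0 0), ?_, fun u B _ _ x _ => by simp [iterLie, jet]⟩
    exact hH.comp (contDiff_jetSpace_value 0)
  | succ j ih =>
    obtain ⟨Ψ, hΨ, h⟩ := ih
    -- The derivative of the j-jet in direction v: each derivative of order k + 1 contracted with v
    -- in its first slot.
    let sh : JetSpace (j + 1) E W → E → JetSpace j E W := fun J v k =>
      continuousMultilinearCurryLeftEquiv ℝ (fun _ : Fin ((k : ℕ) + 1) => E) W
        (J ⟨k + 1, by omega⟩) v
    let v : JetSpace (j + 1) E W → E := fun J => V (J ⟨0, Nat.succ_pos _⟩ 0)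
    have hv : ContDiff ℝ ∞ v := hV.comp (contDiff_jetSpace_value (j + 1))
    refine ⟨fun J => fderiv ℝ Ψ (fun k : Fin (j + 1) => J ⟨k, by omega⟩) (sh J (v J)), ?_, ?_⟩
    · have hp : ContDiff ℝ ∞ (fun (J : JetSpace (j + 1) E W) =>
          ((fun k : Fin (j + 1) => J ⟨k, by omega⟩) : JetSpace j E W)) :=
        contDiff_pi.2 fun k => contDiff_jetSpace_apply (j + 1) ⟨k, by omega⟩
      refine ((hΨ.fderiv_right (by simp)).comp hp).clm_apply ?_
      refine contDiff_pi.2 fun k => ContDiff.clm_apply ?_ hv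
      have hc : ContDiff ℝ ∞ (continuousMultilinearCurryLeftEquiv ℝ
          (fun _ : Fin ((k : ℕ) + 1) => E) W) := LinearIsometryEquiv.contDiff _
      exact hc.comp (contDiff_jetSpace_apply (j + 1) ⟨k + 1, by omega⟩)
    · intro u B hB hu x hx
      have h1 : iterLie (V ∘ u) (H ∘ u) j =ᶠ[𝓝 x] Ψ ∘ jet j u :=
        Filter.eventuallyEq_of_mem (hB.mem_nhds hx) (h u B hB hu)
      have h2 := ((hΨ.differentiable (by simp)).differentiableAt
        (x := jet j u x)).hasFDerivAt.comp x
        (hasFDerivAt_jet (hu.contDiffAt (hB.mem_nhds hx)) j)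
      simp only [iterLie]
      rw [h1.fderiv_eq, h2.fderiv]
      simp only [ContinuousLinearMap.comp_apply, Function.comp_apply]
      congr 1

end Jets

/-! ### Density by Hausdorff dimension and by Sard's theorem -/

section Density

variable {E : Type*} [NormedAddCommGroup E] [NormedSpace ℝ E]

/-- The polynomial with given coefficients. -/
noncomputable def coeffPoly {N : ℕ} (c : Fin N → ℝ) : Polynomial ℝ :=
  ∑ a : Fin N, Polynomial.monomial (a : ℕ) (c a)

theorem coeffPoly_coeff {N : ℕ} (c : Fin N → ℝ) (a : Fin N) : (coeffPoly c).coeff a = c a := by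
  simp [coeffPoly, Polynomial.coeff_monomial, Fin.val_inj]

theorem coeffPoly_natDegree_lt {N : ℕ} (c : Fin (N + 1) → ℝ) :
    (coeffPoly c).natDegree < N + 1 := by
  refine Nat.lt_succ_of_le (Polynomial.natDegree_sum_le_of_forall_le _ _ fun a _ => ?_)
  exact (Polynomial.natDegree_monomial_le _).trans (Nat.le_of_lt_succ a.2)

/-- Taylor expansion at t, with the powers of X - t expanded. The point is that the coefficients
depend smoothly on t and on the derivatives at t. -/
theorem Polynomial.coeff_eq_sum_derivative {N : ℕ} (p : Polynomial ℝ) (hp : p.natDegree < N)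
    (t : ℝ) (a : ℕ) :
    p.coeff a = ∑ k ∈ Finset.range N, ((Polynomial.derivative^[k] p).eval t / k.factorial) *
      ((-t) ^ (k - a) * (k.choose a)) := by
  conv_lhs => rw [← Polynomial.sum_taylor_eq p t]
  rw [Polynomial.sum_over_range' _ (by simp) N (by simpa using hp), Polynomial.finsetSum_coeff]
  refine Finset.sum_congr rfl fun k _ => ?_
  rw [Polynomial.coeff_C_mul, Polynomial.taylor_coeff, sub_eq_add_neg, ← Polynomial.C_neg,
    Polynomial.coeff_X_add_C_pow, ← Polynomial.factorial_smul_hasseDeriv]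
  congr 1
  have : (k.factorial : ℝ) ≠ 0 := by positivity
  simp; field_simp

/-- If all n + 1 derivatives vanish at x, the derivatives of the polynomial at y x are those of h
with opposite sign, and they determine c = Θ x. A C¹ map does not raise Hausdorff dimension, so the
range of Θ on B has dimension at most n < n + 1. -/
theorem dense_perturbation [FiniteDimensional ℝ E] {Y : E → E} {h : E → ℝ} {y : E →L[ℝ] ℝ}
    {B : Set E} (hB : IsOpen B) (hY : ContDiffOn ℝ ∞ Y B) (hh : ContDiffOn ℝ ∞ h B)
    (hy : ∀ x ∈ B, y (Y x) = 1) {n : ℕ} (hn : Module.finrank ℝ E ≤ n) :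
    Dense {c : Fin (n + 1) → ℝ | ∀ x ∈ B, ∃ j ≤ n,
      iterLie Y (h + fun x => (coeffPoly c).eval (y x)) j x ≠ 0} := by
  let Θ : E → Fin (n + 1) → ℝ := fun x a => ∑ k ∈ Finset.range (n + 1),
    (-(iterLie Y h k x) / k.factorial) * ((-(y x)) ^ (k - (a : ℕ)) * (k.choose a))
  have hΘ : ContDiffOn ℝ 1 Θ B := by
    refine contDiffOn_pi.2 fun a => ContDiffOn.sum fun k _ => ?_
    have h1 : ContDiffOn ℝ 1 (iterLie Y h k) B :=
      (iterLie_contDiffOn hB hY hh k).of_le (by exact_mod_cast le_top)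
    exact (h1.neg.div_const _).mul
      (((y.contDiff.contDiffOn).neg.pow _).mul contDiffOn_const)
  have hd : dimH (Θ '' B) < Module.finrank ℝ (Fin (n + 1) → ℝ) := by
    have h1 : dimH (Θ '' B) ≤ dimH B := by
      refine dimH_image_le_of_locally_lipschitzOn fun x hx => ?_
      obtain ⟨C, t, ht, hC⟩ :=
        (hΘ.contDiffAt (hB.mem_nhds hx)).exists_lipschitzOnWith
      exact ⟨C, t, mem_nhdsWithin_of_mem_nhds ht, hC⟩
    have h2 : dimH B ≤ Module.finrank ℝ E :=
      (dimH_mono (Set.subset_univ _)).trans (Real.dimH_univ_eq_finrank E).le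
    refine (h1.trans h2).trans_lt ?_
    simp only [Module.finrank_fin_fun]
    exact_mod_cast Nat.lt_succ_of_le hn
  refine (dense_compl_of_dimH_lt_finrank hd).mono fun c hc => ?_
  by_contra hbad
  simp only [Set.mem_ofPred_eq, not_forall, not_exists, not_and, not_not] at hbad
  obtain ⟨x, hx, hj⟩ := hbad
  refine hc ⟨x, hx, funext fun a => ?_⟩
  rw [← coeffPoly_coeff c a,
    Polynomial.coeff_eq_sum_derivative _ (coeffPoly_natDegree_lt c) (y x)]
  refine Finset.sum_congr rfl fun k hk => ?_
  have hp : ContDiffOn ℝ ∞ (fun x => (coeffPoly c).eval (y x)) B :=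
    (((coeffPoly c).contDiff_aeval ∞).comp y.contDiff).contDiffOn
  have := hj k (Nat.le_of_lt_succ (Finset.mem_range.1 hk))
  rw [iterLie_add hB hY hh hp k hx, Pi.add_apply, iterLie_polynomial hB hy _ k hx] at this
  rw [← eq_neg_of_add_eq_zero_right this]

/-- Sard's theorem in equal dimensions: c is bad only if -c is a critical value of X, and these form
a null set. -/
theorem dense_translation_regular [FiniteDimensional ℝ E] {X : E → E} {B : Set E}
    (hB : IsOpen B) (hX : ContDiffOn ℝ ∞ X B) :
    Dense {c : E | ∀ x ∈ B, X x + c = 0 → (fderiv ℝ X x).det ≠ 0} := by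
  borelize E
  let s : Set E := {x ∈ B | (fderiv ℝ X x).det = 0}
  have h0 : MeasureTheory.Measure.addHaar (X '' s) = 0 := by
    refine MeasureTheory.addHaar_image_eq_zero_of_det_fderivWithin_eq_zero _
      (f' := fun x => fderiv ℝ X x) (fun x hx => ?_) (fun x hx => hx.2)
    exact ((hX.contDiffAt (hB.mem_nhds hx.1)).differentiableAt
      (by simp)).hasFDerivAt.hasFDerivWithinAt
  have h1 : Dense (X '' s)ᶜ := MeasureTheory.Measure.dense_of_ae
    (μ := MeasureTheory.Measure.addHaar) (MeasureTheory.compl_mem_ae_iff.2 h0)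
  refine (h1.preimage (Homeomorph.neg E).isOpenMap).mono fun c hc x hx h2 h3 => ?_
  have h4 : -c ∉ X '' s := hc
  exact h4 ⟨x, ⟨hx, h3⟩, eq_neg_of_add_eq_zero_left h2⟩

end Density

/-- Used to normalise speeds: the rescaling must be smooth everywhere to define a smooth function of
jets, but needs to invert only speeds bounded away from 0. -/
theorem exists_smooth_inv {δ : ℝ} (hδ : 0 < δ) :
    ∃ ρ : ℝ → ℝ, ContDiff ℝ ∞ ρ ∧ ∀ t, δ ≤ |t| → ρ t * t = 1 := by
  let χ : ContDiffBump (0 : ℝ) := ⟨δ / 4, δ / 2, by positivity, by linarith⟩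
  refine ⟨fun t => (1 - χ t) * t⁻¹, ?_, fun t ht => ?_⟩
  · rw [contDiff_iff_contDiffAt]
    intro t
    by_cases ht : t = 0
    · subst ht
      refine (contDiffAt_const (c := (0 : ℝ))).congr_of_eventuallyEq ?_
      filter_upwards [χ.eventuallyEq_one] with s hs
      simp [hs]
    · exact (contDiffAt_const.sub χ.contDiff.contDiffAt).mul (contDiffAt_inv _ ht)
  · have h1 : χ t = 0 := by
      apply χ.zero_of_le_dist
      simp only [χ, dist_zero_right, Real.norm_eq_abs]
      linarith
    have : t ≠ 0 := by rintro rfl; simp at ht; linarith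
    simp [h1, this]

theorem contDiff_smul_of_tsupport {E F : Type*} [NormedAddCommGroup E] [NormedSpace ℝ E]
    [NormedAddCommGroup F] [NormedSpace ℝ F] {χ : E → ℝ} {f : E → F} {U : Set E}
    (hU : IsOpen U) (hχ : ContDiff ℝ ∞ χ) (hf : ContDiffOn ℝ ∞ f U) (h : tsupport χ ⊆ U) :
    ContDiff ℝ ∞ (fun x => χ x • f x) := by
  rw [contDiff_iff_contDiffAt]
  intro x
  by_cases hx : x ∈ tsupport χ
  · exact hχ.contDiffAt.smul (hf.contDiffAt (hU.mem_nhds (h hx)))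
  · refine (contDiffAt_const (c := (0 : F))).congr_of_eventuallyEq ?_
    filter_upwards [(isClosed_tsupport χ).isOpen_compl.mem_nhds hx] with z hz
    simp [image_eq_zero_of_notMem_tsupport hz]

/-! ### Derivatives in one variable of a jointly smooth map -/

section PartialDerivatives

variable {A E F : Type*} [NormedAddCommGroup A] [NormedSpace ℝ A]
  [NormedAddCommGroup E] [NormedSpace ℝ E] [NormedAddCommGroup F] [NormedSpace ℝ F]

theorem iteratedFDeriv_prodMk_right {Φ : A × E → F} {Ω : Set (A × E)} (hΩ : IsOpen Ω)
    (hΦ : ContDiffOn ℝ ∞ Φ Ω) {z : A × E} (hz : z ∈ Ω) (k : ℕ) :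
    iteratedFDeriv ℝ k (fun x => Φ (z.1, x)) z.2 =
      (iteratedFDeriv ℝ k Φ z).compContinuousLinearMap
        fun _ => ContinuousLinearMap.inr ℝ A E := by
  -- The translation turns the affine inclusion of the slice into the linear map `inr`.
  let Φ' : A × E → F := fun w => Φ ((z.1, 0) + w)
  let Ω' : Set (A × E) := (fun w => (z.1, 0) + w) ⁻¹' Ω
  have hΩ' : IsOpen Ω' := hΩ.preimage (by fun_prop)
  have hΦ' : ContDiffOn ℝ ∞ Φ' Ω' := hΦ.comp (by fun_prop) fun w hw => hw
  have hz' : ContinuousLinearMap.inr ℝ A E z.2 ∈ Ω' := by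
    simpa [Ω'] using hz
  have hpre : IsOpen (ContinuousLinearMap.inr ℝ A E ⁻¹' Ω') :=
    hΩ'.preimage (ContinuousLinearMap.continuous _)
  have h1 := (ContinuousLinearMap.inr ℝ A E).iteratedFDerivWithin_comp_right hΦ'
    hΩ'.uniqueDiffOn hpre.uniqueDiffOn hz' (i := k) (by exact_mod_cast le_top)
  rw [iteratedFDerivWithin_of_isOpen k hpre hz', iteratedFDerivWithin_of_isOpen k hΩ' hz'] at h1
  have h2 : (fun x => Φ (z.1, x)) = Φ' ∘ ContinuousLinearMap.inr ℝ A E := by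
    ext x; simp [Φ']
  rw [h2, h1, iteratedFDeriv_comp_add_left]
  simp

theorem continuousOn_iteratedFDeriv_prodMk_right {Φ : A × E → F} {Ω : Set (A × E)}
    (hΩ : IsOpen Ω) (hΦ : ContDiffOn ℝ ∞ Φ Ω) (k : ℕ) :
    ContinuousOn (fun z : A × E => iteratedFDeriv ℝ k (fun x => Φ (z.1, x)) z.2) Ω := by
  have h1 : ContinuousOn (iteratedFDeriv ℝ k Φ) Ω :=
    (hΦ.continuousOn_iteratedFDerivWithin (m := k) (by exact_mod_cast le_top)
      hΩ.uniqueDiffOn).congr fun z hz => (iteratedFDerivWithin_of_isOpen k hΩ hz).symm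
  refine ContinuousOn.congr ?_ fun z hz => iteratedFDeriv_prodMk_right hΩ hΦ hz k
  exact (ContinuousMultilinearMap.compContinuousLinearMapL
    (fun _ : Fin k => ContinuousLinearMap.inr ℝ A E)).continuous.comp_continuousOn h1

end PartialDerivatives

/-! ### Vector fields in charts -/

section Charts

variable {E : Type*} [NormedAddCommGroup E] [NormedSpace ℝ E]
  {M : Type*} [TopologicalSpace M] [ChartedSpace E M] [IsManifold 𝓘(ℝ, E) ∞ M]

/-- The chart of the tangent bundle over the preferred chart of the manifold at a point. -/
noncomputable def tangentChart (p₀ : M) :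
    OpenPartialHomeomorph (TangentBundle 𝓘(ℝ, E) M) (ModelProd E E) :=
  chartAt (ModelProd E E) (⟨p₀, 0⟩ : TangentBundle 𝓘(ℝ, E) M)

/-- The representative of a vector field in the preferred chart at a point. -/
noncomputable def localRep (p₀ : M) (X : SmoothVectorField E M) : E → E × E :=
  (tangentChart p₀).extend 𝓘(ℝ, E).tangent ∘ X.toMap ∘ (chartAt E p₀).symm

/-- The coordinates of a vector field in the preferred chart at a point. -/
noncomputable def coords (p₀ : M) (X : SmoothVectorField E M) (x : E) : E := (localRep p₀ X x).2

theorem tangentChart_mem_maximalAtlas (p₀ : M) :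
    tangentChart p₀ ∈ IsManifold.maximalAtlas 𝓘(ℝ, E).tangent ∞ (TangentBundle 𝓘(ℝ, E) M) :=
  IsManifold.chart_mem_maximalAtlas _

theorem mem_tangentChart_source (p₀ : M) (v : TangentBundle 𝓘(ℝ, E) M) :
    v ∈ (tangentChart p₀).source ↔ v.1 ∈ (chartAt E p₀).source :=
  TangentBundle.mem_chart_source_iff _ _

theorem coords_eq_trivialization (p₀ : M) (X : SmoothVectorField E M) (x : E) :
    coords p₀ X x = (trivializationAt E (TangentSpace 𝓘(ℝ, E)) p₀
      ⟨(chartAt E p₀).symm x, X ((chartAt E p₀).symm x)⟩).2 := rfl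

theorem coords_eq_linearMap (p₀ : M) (X : SmoothVectorField E M) {x : E}
    (hx : x ∈ (chartAt E p₀).target) :
    coords p₀ X x = (trivializationAt E (TangentSpace 𝓘(ℝ, E)) p₀).continuousLinearMapAt ℝ
      ((chartAt E p₀).symm x) (X ((chartAt E p₀).symm x)) := by
  rw [coords_eq_trivialization, Bundle.Trivialization.continuousLinearMapAt_apply_of_mem]
  exact (chartAt E p₀).map_target hx

theorem localRep_eq (p₀ : M) (X : SmoothVectorField E M) {x : E}
    (hx : x ∈ (chartAt E p₀).target) : localRep p₀ X x = (x, coords p₀ X x) := by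
  refine Prod.ext ?_ rfl
  change chartAt E p₀ ((chartAt E p₀).symm x) = x
  exact (chartAt E p₀).right_inv hx

theorem localRep_contDiffOn (p₀ : M) (X : SmoothVectorField E M) :
    ContDiffOn ℝ ∞ (localRep p₀ X) (chartAt E p₀).target := by
  rw [← contMDiffOn_iff_contDiffOn]
  have h1 := OpenPartialHomeomorph.contMDiffOn_extend
    (tangentChart_mem_maximalAtlas (E := E) p₀)
  have h2 := contMDiffOn_symm_of_mem_maximalAtlas (I := 𝓘(ℝ, E)) (n := ∞)
    (IsManifold.chart_mem_maximalAtlas (I := 𝓘(ℝ, E)) p₀)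
  have h3 : ContMDiff 𝓘(ℝ, E) 𝓘(ℝ, E).tangent ∞ (SmoothVectorField.toMap X) :=
    (SmoothVectorField.toMap X).contMDiff
  refine h1.comp (h3.comp_contMDiffOn h2) fun x hx => ?_
  exact (mem_tangentChart_source _ _).2 ((chartAt E p₀).map_target hx)

theorem coords_contDiffOn (p₀ : M) (X : SmoothVectorField E M) :
    ContDiffOn ℝ ∞ (coords p₀ X) (chartAt E p₀).target :=
  contDiff_snd.comp_contDiffOn (localRep_contDiffOn p₀ X)

theorem SmoothVectorField.sum_apply {ι : Type*} (s : Finset ι) (W : ι → SmoothVectorField E M)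
    (p : M) : (∑ a ∈ s, W a) p = ∑ a ∈ s, W a p :=
  map_sum ((Pi.evalAddMonoidHom (fun p : M => TangentSpace 𝓘(ℝ, E) p) p).comp
    (ContMDiffSection.coeAddHom 𝓘(ℝ, E) E ∞ (TangentSpace 𝓘(ℝ, E) : M → Type _))) W s

theorem coords_add_sum {ι : Type*} [Fintype ι] (p₀ : M) (X : SmoothVectorField E M)
    (W : ι → SmoothVectorField E M) (c : ι → ℝ) {x : E} (hx : x ∈ (chartAt E p₀).target) :
    coords p₀ (X + ∑ a, c a • W a) x = coords p₀ X x + ∑ a, c a • coords p₀ (W a) x := by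
  simp only [coords_eq_linearMap p₀ _ hx, ContMDiffSection.coe_add, Pi.add_apply, map_add,
    SmoothVectorField.sum_apply, map_sum, ContMDiffSection.coe_smul, Pi.smul_apply,
    map_smul]

theorem coords_eq_zero_iff (p₀ : M) (X : SmoothVectorField E M) {q : M}
    (hq : q ∈ (chartAt E p₀).source) : coords p₀ X (chartAt E p₀ q) = 0 ↔ X q = 0 := by
  rw [coords_eq_linearMap p₀ X ((chartAt E p₀).map_source hq), (chartAt E p₀).left_inv hq,
    ← Bundle.Trivialization.coe_continuousLinearEquivAt_eq _ (R := ℝ) hq]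
  exact ContinuousLinearEquiv.map_eq_zero_iff _

theorem coords_eq_mfderiv (p₀ : M) (X : SmoothVectorField E M) {q : M}
    (hq : q ∈ (chartAt E p₀).source) :
    coords p₀ X (chartAt E p₀ q) = mfderiv 𝓘(ℝ, E) 𝓘(ℝ, E) (chartAt E p₀) q (X q) := by
  rw [coords_eq_linearMap p₀ X ((chartAt E p₀).map_source hq), (chartAt E p₀).left_inv hq,
    TangentBundle.continuousLinearMapAt_trivializationAt hq]
  rfl

theorem hasDerivAt_chart_comp (p₀ : M) (X : SmoothVectorField E M) {γ : ℝ → M} {s : Set ℝ}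
    (hs : IsOpen s) (hγ : IsMIntegralCurveOn γ X s) {t : ℝ} (ht : t ∈ s)
    (hq : γ t ∈ (chartAt E p₀).source) :
    HasDerivAt (chartAt E p₀ ∘ γ) (coords p₀ X (chartAt E p₀ (γ t))) t := by
  have h1 := (hγ t ht).hasMFDerivAt (hs.mem_nhds ht)
  have h2 := (mdifferentiableAt_atlas (I := 𝓘(ℝ, E)) (chart_mem_atlas E p₀) hq).hasMFDerivAt
  let D : E →L[ℝ] E := mfderiv 𝓘(ℝ, E) 𝓘(ℝ, E) (chartAt E p₀) (γ t)
  let v : E := X (γ t)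
  have h3 : HasFDerivAt (chartAt E p₀ ∘ γ) (D.comp ((1 : ℝ →L[ℝ] ℝ).smulRight v)) t :=
    hasMFDerivAt_iff_hasFDerivAt.1 (h2.comp t h1)
  rw [coords_eq_mfderiv p₀ X hq]
  refine h3.hasDerivAt.congr_deriv ?_
  exact congrArg D (one_smul ℝ v)

theorem exists_vectorField_coords_eq [T2Space M] (p₀ : M) {w : E → E} (hw : ContDiff ℝ ∞ w)
    {K : Set E} (hK : IsCompact K) (hKt : K ⊆ (chartAt E p₀).target) (hwK : ∀ x ∉ K, w x = 0) :
    ∃ W : SmoothVectorField E M, (∀ x ∈ (chartAt E p₀).target, coords p₀ W x = w x) ∧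
      ∀ p ∉ (chartAt E p₀).symm '' K, W p = 0 := by
  let e := trivializationAt E (TangentSpace 𝓘(ℝ, E) : M → Type _) p₀
  let W : ∀ p : M, TangentSpace 𝓘(ℝ, E) p := fun p => e.symmL ℝ p (w (chartAt E p₀ p))
  have hcl : IsClosed ((chartAt E p₀).symm '' K) :=
    (hK.image_of_continuousOn ((chartAt E p₀).continuousOn_symm.mono hKt)).isClosed
  have hW0 : ∀ p ∉ (chartAt E p₀).symm '' K, W p = 0 := by
    intro p hp
    by_cases hs : p ∈ (chartAt E p₀).source
    · have : chartAt E p₀ p ∉ K := fun h => hp ⟨_, h, (chartAt E p₀).left_inv hs⟩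
      simp [W, hwK _ this]
    · exact e.symmL_apply_of_notMem hs _
  have hWe : ∀ p ∈ (chartAt E p₀).source, (e ⟨p, W p⟩).2 = w (chartAt E p₀ p) := by
    intro p hp
    have := e.continuousLinearMapAt_symmL (R := ℝ) (b := p) hp (w (chartAt E p₀ p))
    exact (e.continuousLinearMapAt_apply_of_mem ℝ hp _).symm.trans this
  refine ⟨⟨W, fun p => ?_⟩, fun x hx => ?_, hW0⟩
  · by_cases hs : p ∈ (chartAt E p₀).source
    · rw [e.contMDiffAt_section_iff hs]
      have h1 : ContMDiffAt 𝓘(ℝ, E) 𝓘(ℝ, E) ∞ (fun q => w (chartAt E p₀ q)) p :=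
        hw.contMDiff.contMDiffAt.comp p ((contMDiffOn_of_mem_maximalAtlas
          (IsManifold.chart_mem_maximalAtlas p₀)).contMDiffAt
            ((chartAt E p₀).open_source.mem_nhds hs))
      exact h1.congr_of_eventuallyEq
        (Filter.eventuallyEq_of_mem ((chartAt E p₀).open_source.mem_nhds hs) hWe)
    · have hp : p ∉ (chartAt E p₀).symm '' K := by
        rintro ⟨x, hx, rfl⟩
        exact hs ((chartAt E p₀).map_target (hKt hx))
      refine (Bundle.contMDiff_zeroSection ℝ (TangentSpace 𝓘(ℝ, E) : M → Type _)
        (n := ∞) (IB := 𝓘(ℝ, E)) (F := E)).contMDiffAt.congr_of_eventuallyEq ?_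
      filter_upwards [hcl.isOpen_compl.mem_nhds hp] with q hq
      rw [hW0 q hq]; rfl
  · rw [coords_eq_trivialization]
    have := hWe _ ((chartAt E p₀).map_target hx)
    rwa [(chartAt E p₀).right_inv hx] at this

end Charts

/-! ### Finite-dimensional perturbations and the strong topology -/

section Perturbation

variable {E : Type*} [NormedAddCommGroup E] [NormedSpace ℝ E]
  {M : Type*} [TopologicalSpace M] [ChartedSpace E M] [IsManifold 𝓘(ℝ, E) ∞ M]
  {ι : Type*} [Fintype ι]

/-- A vector field perturbed by a linear combination of vector fields. -/
noncomputable def perturb (X : SmoothVectorField E M) (W : ι → SmoothVectorField E M)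
    (c : ι → ℝ) : SmoothVectorField E M := X + ∑ a, c a • W a

theorem perturb_apply (X : SmoothVectorField E M) (W : ι → SmoothVectorField E M)
    (c : ι → ℝ) (p : M) : perturb X W c p = X p + ∑ a, c a • W a p := by
  simp [perturb, SmoothVectorField.sum_apply]

theorem trivialization_perturb (p₀ : M) (X : SmoothVectorField E M)
    (W : ι → SmoothVectorField E M) (c : ι → ℝ) {q : M} (hq : q ∈ (chartAt E p₀).source) :
    (trivializationAt E (TangentSpace 𝓘(ℝ, E)) p₀ ⟨q, perturb X W c q⟩).2 =
      coords p₀ X (chartAt E p₀ q) + ∑ a, c a • coords p₀ (W a) (chartAt E p₀ q) := by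
  rw [← coords_add_sum p₀ X W c ((chartAt E p₀).map_source hq), coords_eq_trivialization,
    (chartAt E p₀).left_inv hq]
  rfl

/-- Joint smoothness in the parameter and the point is what makes the derivatives in the point
depend continuously on the parameter. -/
theorem contMDiffOn_perturb (X : SmoothVectorField E M) (W : ι → SmoothVectorField E M)
    {φ : OpenPartialHomeomorph M E} (hφ : φ ∈ IsManifold.maximalAtlas 𝓘(ℝ, E) ∞ M) :
    ContMDiffOn 𝓘(ℝ, (ι → ℝ) × E) 𝓘(ℝ, E).tangent ∞
      (fun z : (ι → ℝ) × E => (perturb X W z.1).toMap (φ.symm z.2))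
      (Set.univ ×ˢ φ.target) := by
  intro z hz
  have hz2 : z.2 ∈ φ.target := hz.2
  refine ContMDiffAt.contMDiffWithinAt ?_
  have h1 : ContMDiffAt 𝓘(ℝ, (ι → ℝ) × E) 𝓘(ℝ, E) ∞
      (fun z : (ι → ℝ) × E => φ.symm z.2) z :=
    ((contMDiffOn_symm_of_mem_maximalAtlas hφ).contMDiffAt
      (φ.open_target.mem_nhds hz2)).comp z contDiff_snd.contMDiff.contMDiffAt
  rw [Bundle.contMDiffAt_totalSpace]
  refine ⟨h1, ?_⟩
  set p₀ : M := φ.symm z.2 with hp₀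
  have hsrc : ∀ᶠ w in 𝓝 z, φ.symm w.2 ∈ (chartAt E p₀).source :=
    h1.continuousAt.eventually ((chartAt E p₀).open_source.mem_nhds (mem_chart_source E p₀))
  have h2 : ContMDiffAt 𝓘(ℝ, (ι → ℝ) × E) 𝓘(ℝ, E) ∞
      (fun w : (ι → ℝ) × E => chartAt E p₀ (φ.symm w.2)) z :=
    ((contMDiffOn_of_mem_maximalAtlas (IsManifold.chart_mem_maximalAtlas p₀)).contMDiffAt
      ((chartAt E p₀).open_source.mem_nhds (mem_chart_source E p₀))).comp z h1
  have h3 (Y : SmoothVectorField E M) : ContMDiffAt 𝓘(ℝ, (ι → ℝ) × E) 𝓘(ℝ, E) ∞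
      (fun w : (ι → ℝ) × E => coords p₀ Y (chartAt E p₀ (φ.symm w.2))) z := by
    refine ContMDiffAt.comp (g := coords p₀ Y) z (ContDiffAt.contMDiffAt ?_) h2
    exact (coords_contDiffOn p₀ Y).contDiffAt
      ((chartAt E p₀).open_target.mem_nhds (mem_chart_target E p₀))
  have h4 : ContDiffAt ℝ ∞ (fun w : (ι → ℝ) × E =>
      coords p₀ X (chartAt E p₀ (φ.symm w.2)) +
        ∑ a, w.1 a • coords p₀ (W a) (chartAt E p₀ (φ.symm w.2))) z := by
    refine (h3 X).contDiffAt.add (ContDiffAt.sum fun a _ => ContDiffAt.smul ?_ (h3 _).contDiffAt)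
    exact ((contDiff_apply ℝ ℝ a).comp contDiff_fst).contDiffAt
  refine h4.contMDiffAt.congr_of_eventuallyEq ?_
  filter_upwards [hsrc] with w hw
  exact trivialization_perturb p₀ X W w.1 hw

theorem eventually_perturb_mem (X : SmoothVectorField E M) (W : ι → SmoothVectorField E M)
    (f : C^∞⟮𝓘(ℝ, E), M; 𝓘(ℝ, E).tangent, TangentBundle 𝓘(ℝ, E) M⟯)
    {φ : OpenPartialHomeomorph M E} (hφ : φ ∈ IsManifold.maximalAtlas 𝓘(ℝ, E) ∞ M)
    {ψ : OpenPartialHomeomorph (TangentBundle 𝓘(ℝ, E) M) (ModelProd E E)}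
    (hψ : ψ ∈ IsManifold.maximalAtlas 𝓘(ℝ, E).tangent ∞ (TangentBundle 𝓘(ℝ, E) M))
    {K : Set M} (hK : IsCompact K) (hKφ : K ⊆ φ.source) (hf : Set.MapsTo f K ψ.source)
    (r : ℕ) (ε : ℝ) (c₀ : ι → ℝ)
    (h₀ : Set.MapsTo (perturb X W c₀).toMap K ψ.source ∧ ∀ x ∈ K, ∀ k ≤ r,
      ‖iteratedFDeriv ℝ k (ψ.extend 𝓘(ℝ, E).tangent ∘ (perturb X W c₀).toMap ∘ φ.symm) (φ x)
        - iteratedFDeriv ℝ k (ψ.extend 𝓘(ℝ, E).tangent ∘ f ∘ φ.symm) (φ x)‖ < ε) :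
    ∀ᶠ c in 𝓝 c₀, Set.MapsTo (perturb X W c).toMap K ψ.source ∧ ∀ x ∈ K, ∀ k ≤ r,
      ‖iteratedFDeriv ℝ k (ψ.extend 𝓘(ℝ, E).tangent ∘ (perturb X W c).toMap ∘ φ.symm) (φ x)
        - iteratedFDeriv ℝ k (ψ.extend 𝓘(ℝ, E).tangent ∘ f ∘ φ.symm) (φ x)‖ < ε := by
  let g : (ι → ℝ) × E → TangentBundle 𝓘(ℝ, E) M :=
    fun z => (perturb X W z.1).toMap (φ.symm z.2)
  have hg := contMDiffOn_perturb X W hφ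
  let Ω : Set ((ι → ℝ) × E) := (Set.univ ×ˢ φ.target) ∩ g ⁻¹' ψ.source
  have hΩ : IsOpen Ω := hg.continuousOn.isOpen_inter_preimage
    (isOpen_univ.prod φ.open_target) ψ.open_source
  have hψe := OpenPartialHomeomorph.contMDiffOn_extend hψ
  have hΦ : ContDiffOn ℝ ∞ (fun z => ψ.extend 𝓘(ℝ, E).tangent (g z)) Ω := by
    rw [← contMDiffOn_iff_contDiffOn]
    exact hψe.comp (hg.mono Set.inter_subset_left) fun z hz => hz.2
  let Ωf : Set E := φ.target ∩ (f ∘ φ.symm) ⁻¹' ψ.source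
  have hfφ : ContMDiffOn 𝓘(ℝ, E) 𝓘(ℝ, E).tangent ∞ (f ∘ φ.symm) φ.target :=
    f.contMDiff.comp_contMDiffOn (contMDiffOn_symm_of_mem_maximalAtlas hφ)
  have hΩf : IsOpen Ωf := hfφ.continuousOn.isOpen_inter_preimage φ.open_target ψ.open_source
  have hfd : ContDiffOn ℝ ∞ (ψ.extend 𝓘(ℝ, E).tangent ∘ f ∘ φ.symm) Ωf := by
    rw [← contMDiffOn_iff_contDiffOn]
    exact hψe.comp (hfφ.mono Set.inter_subset_left) fun z hz => hz.2
  have key : ∀ᶠ c in 𝓝 c₀, ∀ x ∈ φ '' K, (c, x) ∈ Ω ∧ ∀ k ∈ Finset.range (r + 1),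
      ‖iteratedFDeriv ℝ k (fun x => ψ.extend 𝓘(ℝ, E).tangent (g (c, x))) x
        - iteratedFDeriv ℝ k (ψ.extend 𝓘(ℝ, E).tangent ∘ f ∘ φ.symm) x‖ < ε := by
    refine IsCompact.eventually_forall_of_forall_eventually
      (hK.image_of_continuousOn (φ.continuousOn.mono hKφ)) ?_
    rintro _ ⟨p, hp, rfl⟩
    have hpt : φ p ∈ φ.target := φ.map_source (hKφ hp)
    have hpΩ : (c₀, φ p) ∈ Ω := by
      refine ⟨⟨trivial, hpt⟩, ?_⟩
      have := h₀.1 hp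
      rw [← φ.left_inv (hKφ hp)] at this
      exact this
    have hpΩf : φ p ∈ Ωf := by
      refine ⟨hpt, ?_⟩
      have := hf hp
      rw [← φ.left_inv (hKφ hp)] at this
      exact this
    refine Filter.Eventually.and (hΩ.mem_nhds hpΩ) ((Filter.eventually_all_finset _).2 fun k hk => ?_)
    have c1 := (continuousOn_iteratedFDeriv_prodMk_right hΩ hΦ k).continuousAt
      (hΩ.mem_nhds hpΩ)
    have c2 : ContinuousAt (fun z : (ι → ℝ) × E =>
        iteratedFDeriv ℝ k (ψ.extend 𝓘(ℝ, E).tangent ∘ f ∘ φ.symm) z.2) (c₀, φ p) := by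
      have h1 : ContinuousOn (iteratedFDeriv ℝ k
          (ψ.extend 𝓘(ℝ, E).tangent ∘ f ∘ φ.symm)) Ωf :=
        (hfd.continuousOn_iteratedFDerivWithin (m := k) (by exact_mod_cast le_top)
          hΩf.uniqueDiffOn).congr fun z hz => (iteratedFDerivWithin_of_isOpen k hΩf hz).symm
      exact ContinuousAt.comp (f := Prod.snd) (x := (c₀, φ p))
        (h1.continuousAt (hΩf.mem_nhds hpΩf)) continuousAt_snd
    exact (c1.sub c2).norm.eventually
      (gt_mem_nhds (h₀.2 p hp k (Nat.le_of_lt_succ (Finset.mem_range.1 hk))))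
  filter_upwards [key] with c hc
  refine ⟨fun p hp => ?_, fun p hp k hk => ?_⟩
  · have := (hc (φ p) ⟨p, hp, rfl⟩).1.2
    rw [Set.mem_preimage] at this
    simp only [g, φ.left_inv (hKφ hp)] at this
    exact this
  · exact (hc (φ p) ⟨p, hp, rfl⟩).2 k (Finset.mem_range.2 (Nat.lt_succ_of_le hk))

/-- The common compact support is essential: by local finiteness it meets only finitely many chart
domains of a basic set, and over the other charts the field does not change with c. -/
theorem continuous_perturb (X : SmoothVectorField E M) (W : ι → SmoothVectorField E M)
    {S : Set M} (hS : IsCompact S) (hW : ∀ a, ∀ p ∉ S, W a p = 0) :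
    Continuous (perturb X W) := by
  refine continuous_induced_rng.2 (continuous_generateFrom_iff.2 ?_)
  rintro _ ⟨f, r, κ, φ, ψ, K, ε, hφ, hψ, hlf, hK, hε, rfl⟩
  rw [isOpen_iff_mem_nhds]
  intro c₀ hc₀
  have hfin := hlf.finite_nonempty_inter_compact hS
  have h1 : ∀ᶠ c in 𝓝 c₀, ∀ i ∈ {i | ((φ i).source ∩ S).Nonempty},
      Set.MapsTo (perturb X W c).toMap (K i) (ψ i).source ∧ ∀ x ∈ K i, ∀ k ≤ r,
      ‖iteratedFDeriv ℝ k ((ψ i).extend 𝓘(ℝ, E).tangent ∘ (perturb X W c).toMap ∘ (φ i).symm)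
        (φ i x) - iteratedFDeriv ℝ k ((ψ i).extend 𝓘(ℝ, E).tangent ∘ f ∘ (φ i).symm) (φ i x)‖
          < ε i := by
    refine (Filter.eventually_all_finite hfin).2 fun i _ => ?_
    exact eventually_perturb_mem X W f (hφ i) (hψ i) (hK i).1 (hK i).2.1 (hK i).2.2 r (ε i) c₀
      (hc₀ i)
  filter_upwards [h1] with c hc i
  by_cases hi : ((φ i).source ∩ S).Nonempty
  · exact hc i hi
  · have heq : Set.EqOn (perturb X W c).toMap (perturb X W c₀).toMap (φ i).source := by
      intro p hp
      have hpS : p ∉ S := fun h => hi ⟨p, hp, h⟩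
      have : perturb X W c p = perturb X W c₀ p := by
        simp [perturb_apply, hW _ p hpS]
      simp only [SmoothVectorField.toMap, ContMDiffMap.coeFn_mk, this]
    obtain ⟨h2, h3⟩ := hc₀ i
    refine ⟨fun p hp => ?_, fun p hp k hk => ?_⟩
    · change (perturb X W c).toMap p ∈ _
      rw [heq ((hK i).2.1 hp)]
      exact h2 hp
    · have h4 : (ψ i).extend 𝓘(ℝ, E).tangent ∘ (perturb X W c).toMap ∘ (φ i).symm
          =ᶠ[𝓝 (φ i p)]
          (ψ i).extend 𝓘(ℝ, E).tangent ∘ (perturb X W c₀).toMap ∘ (φ i).symm := by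
        filter_upwards [(φ i).open_target.mem_nhds ((φ i).map_source ((hK i).2.1 hp))] with x hx
        simp only [Function.comp_apply]
        rw [heq ((φ i).map_target hx)]
      have h5 := h3 p hp k hk
      change ‖iteratedFDeriv ℝ k ((ψ i).extend 𝓘(ℝ, E).tangent ∘ (perturb X W c).toMap ∘
        (φ i).symm) (φ i p) - _‖ < ε i
      rw [(Filter.EventuallyEq.iteratedFDeriv ℝ h4 k).eq_of_nhds]
      exact h5

theorem dense_of_dense_perturb {A : Set (SmoothVectorField E M)}
    (h : ∀ X : SmoothVectorField E M, ∃ (n : ℕ) (W : Fin n → SmoothVectorField E M),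
      Continuous (perturb X W) ∧ Dense {c | perturb X W c ∈ A}) : Dense A := by
  intro X
  obtain ⟨n, W, hc, hd⟩ := h X
  have h0 : perturb X W 0 = X := by simp [perturb]
  rw [← h0]
  exact map_mem_closure hc (hd 0) fun c hc => hc

theorem isOpen_forall_jet_mem (p₀ : M) {K : Set E} (hK : IsCompact K)
    (hKt : K ⊆ (chartAt E p₀).target) (r : ℕ) {O : Set (JetSpace r E (E × E))} (hO : IsOpen O) :
    IsOpen {X : SmoothVectorField E M | ∀ x ∈ K, jet r (localRep p₀ X) x ∈ O} := by
  rw [isOpen_iff_mem_nhds]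
  intro X hX
  have hjet : ContinuousOn (jet r (localRep p₀ X)) K := by
    refine continuousOn_pi.2 fun k => ContinuousOn.mono ?_ hKt
    exact ((localRep_contDiffOn p₀ X).continuousOn_iteratedFDerivWithin (m := (k : ℕ))
      (by exact_mod_cast le_top) (chartAt E p₀).open_target.uniqueDiffOn).congr
      fun z hz => (iteratedFDerivWithin_of_isOpen _ (chartAt E p₀).open_target hz).symm
  -- The jets of X over K form a compact subset of O, so a uniform neighbourhood lies in O. Its
  -- radius is the tolerance of a basic set with a single chart.
  obtain ⟨δ, hδ, hδO⟩ := (hK.image_of_continuousOn hjet).exists_thickening_subset_open hO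
    (Set.image_subset_iff.2 hX)
  let φ := chartAt E p₀
  have hKφ : φ.symm '' K ⊆ φ.source := by
    rintro _ ⟨x, hx, rfl⟩
    exact φ.map_target (hKt hx)
  let U := strongBasicSet X.toMap r (fun _ : PUnit => φ) (fun _ => tangentChart p₀)
    (fun _ => φ.symm '' K) (fun _ => δ)
  have hU : IsOpen (SmoothVectorField.toMap ⁻¹' U) := by
    refine (@isOpen_induced_iff _ _ strongTopology _ _).2 ⟨U, TopologicalSpace.isOpen_generateFrom_of_mem ?_, rfl⟩
    refine ⟨X.toMap, r, PUnit, _, _, _, _, fun _ => IsManifold.chart_mem_maximalAtlas p₀,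
      fun _ => tangentChart_mem_maximalAtlas p₀, locallyFinite_of_finite _, fun _ => ⟨?_, hKφ, ?_⟩,
      fun _ => hδ, rfl⟩
    · exact hK.image_of_continuousOn (φ.continuousOn_symm.mono hKt)
    · exact fun p hp => (mem_tangentChart_source p₀ _).2 (hKφ hp)
  refine Filter.mem_of_superset (hU.mem_nhds ?_) ?_
  · intro _
    refine ⟨fun p hp => (mem_tangentChart_source p₀ _).2 (hKφ hp), fun p hp k hk => ?_⟩
    simpa using hδ
  · intro Y hY x hx
    refine hδO (Metric.mem_thickening_iff.2 ⟨_, ⟨x, hx, rfl⟩, ?_⟩)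
    rw [dist_pi_lt_iff hδ]
    intro k
    have := (hY PUnit.unit).2 (φ.symm x) ⟨x, hx, rfl⟩ k (Nat.le_of_lt_succ k.2)
    rw [φ.right_inv (hKt hx)] at this
    rw [dist_eq_norm]
    exact this

end Perturbation

/-! ### Generic nondegeneracy of equilibria -/

section Equilibria

variable {E : Type*} [NormedAddCommGroup E] [NormedSpace ℝ E]
  {M : Type*} [TopologicalSpace M] [ChartedSpace E M] [IsManifold 𝓘(ℝ, E) ∞ M]

theorem exists_continuous_perturb [T2Space M]
    (p₀ : M) {k : ℕ} (X : SmoothVectorField E M)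
    {w : Fin k → E → E} (hw : ∀ a, ContDiff ℝ ∞ (w a)) {K : Set E} (hK : IsCompact K)
    (hKt : K ⊆ (chartAt E p₀).target) (hwK : ∀ a, ∀ x ∉ K, w a x = 0) :
    ∃ W : Fin k → SmoothVectorField E M, Continuous (perturb X W) ∧
      ∀ c, ∀ x ∈ (chartAt E p₀).target,
        coords p₀ (perturb X W c) x = coords p₀ X x + ∑ a, c a • w a x := by
  choose W hW hW0 using fun a => exists_vectorField_coords_eq p₀ (hw a) hK hKt (hwK a)
  refine ⟨W, continuous_perturb X W
    (hK.image_of_continuousOn ((chartAt E p₀).continuousOn_symm.mono hKt)) hW0,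
    fun c x hx => ?_⟩
  rw [perturb, coords_add_sum p₀ X W c hx]
  simp only [hW _ x hx]

theorem isOpen_nondegenerate (p₀ : M) {K : Set E} (hK : IsCompact K)
    (hKt : K ⊆ (chartAt E p₀).target) :
    IsOpen {X : SmoothVectorField E M | ∀ x ∈ K, coords p₀ X x = 0 →
      (fderiv ℝ (coords p₀ X) x).det ≠ 0} := by
  let D : JetSpace 1 E (E × E) → E →L[ℝ] E := fun J =>
    (ContinuousLinearMap.snd ℝ E E).comp (continuousMultilinearCurryFin1 ℝ E (E × E) (J 1))
  have hD : Continuous D := by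
    refine continuous_const.clm_comp ?_
    exact (continuousMultilinearCurryFin1 ℝ E (E × E)).continuous.comp
      (contDiff_jetSpace_apply 1 1).continuous
  let O : Set (JetSpace 1 E (E × E)) := {J | (J ⟨0, Nat.succ_pos 1⟩ 0).2 = 0 ∧ (D J).det = 0}ᶜ
  have hO : IsOpen O := by
    refine IsClosed.isOpen_compl (self := IsClosed.inter ?_ ?_)
    · exact isClosed_eq (continuous_snd.comp (contDiff_jetSpace_value 1).continuous)
        continuous_const
    · exact isClosed_eq (ContinuousLinearMap.continuous_det.comp hD) continuous_const
  convert isOpen_forall_jet_mem p₀ hK hKt 1 hO using 1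
  ext X
  refine forall₂_congr fun x hx => ?_
  have h1 : D (jet 1 (localRep p₀ X) x) = fderiv ℝ (coords p₀ X) x := by
    have h2 : DifferentiableAt ℝ (localRep p₀ X) x :=
      ((localRep_contDiffOn p₀ X).contDiffAt
        ((chartAt E p₀).open_target.mem_nhds (hKt hx))).differentiableAt (by simp)
    have h3 : HasFDerivAt (coords p₀ X)
        ((ContinuousLinearMap.snd ℝ E E).comp (fderiv ℝ (localRep p₀ X) x)) x :=
      (ContinuousLinearMap.snd ℝ E E).hasFDerivAt.comp x h2.hasFDerivAt
    rw [h3.fderiv]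
    ext v
    simp only [D, ContinuousLinearMap.comp_apply, continuousMultilinearCurryFin1_apply]
    congr 1
    change iteratedFDeriv ℝ 1 (localRep p₀ X) x _ = _
    rw [iteratedFDeriv_one_apply]
    rfl
  have h4 : (jet 1 (localRep p₀ X) x ⟨0, Nat.succ_pos 1⟩ 0).2 = coords p₀ X x := by
    simp [jet, coords]
  change _ ↔ ¬ (_ ∧ _)
  rw [h1, h4, not_and]

/-- Bump functions times a basis realise every constant translation on the ball, so Sard's theorem
applies to the coordinates of X. -/
theorem dense_nondegenerate [FiniteDimensional ℝ E] [T2Space M]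
    (p₀ : M) {ε : ℝ} (hε : 0 < ε)
    (hεt : Metric.closedBall (chartAt E p₀ p₀) (2 * ε) ⊆ (chartAt E p₀).target) :
    Dense {X : SmoothVectorField E M | ∀ x ∈ Metric.ball (chartAt E p₀ p₀) ε, coords p₀ X x = 0 →
      (fderiv ℝ (coords p₀ X) x).det ≠ 0} := by
  refine dense_of_dense_perturb fun X => ?_
  set x₀ := chartAt E p₀ p₀
  let χ : ContDiffBump x₀ := ⟨ε, 2 * ε, hε, by linarith⟩
  let b := Module.finBasis ℝ E
  have hBt : Metric.ball x₀ ε ⊆ (chartAt E p₀).target :=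
    (Metric.ball_subset_closedBall.trans (Metric.closedBall_subset_closedBall
      (by linarith))).trans hεt
  obtain ⟨W, hc, hW⟩ := exists_continuous_perturb p₀ X (w := fun a x => χ x • b a)
    (fun a => χ.contDiff.smul contDiff_const) (isCompact_closedBall x₀ (2 * ε)) hεt
    (fun a x hx => by
      have : χ x = 0 := χ.zero_of_le_dist (by
        simp only [Metric.mem_closedBall, not_le] at hx; exact hx.le)
      simp [this])
  refine ⟨_, W, hc, ?_⟩
  have hd := (dense_translation_regular Metric.isOpen_ball
    ((coords_contDiffOn p₀ X).mono hBt)).preimage b.equivFunL.symm.toHomeomorph.isOpenMap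
  refine hd.mono fun c hcd x hx => ?_
  have hv : ∀ z ∈ Metric.ball x₀ ε,
      coords p₀ (perturb X W c) z = coords p₀ X z + b.equivFunL.symm c := by
    intro z hz
    rw [hW c z (hBt hz)]
    have : χ z = 1 := χ.one_of_mem_closedBall (Metric.ball_subset_closedBall hz)
    simp only [this, one_smul]
    congr 1
    exact (b.equivFun_symm_apply c).symm
  have hf : fderiv ℝ (coords p₀ (perturb X W c)) x = fderiv ℝ (coords p₀ X) x := by
    rw [(Filter.eventuallyEq_of_mem (Metric.isOpen_ball.mem_nhds hx) hv).fderiv_eq,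
      fderiv_add_const]
  rw [hv x hx, hf]
  exact hcd x hx

/-- An invertible derivative is bounded below, so the coordinates of X do not vanish at nearby
points of the chart other than q. -/
theorem eventually_ne_zero_of_nondegenerate [FiniteDimensional ℝ E]
    (p₀ : M) (X : SmoothVectorField E M) {q : M}
    (hq : q ∈ (chartAt E p₀).source)
    (hdet : (fderiv ℝ (coords p₀ X) (chartAt E p₀ q)).det ≠ 0) :
    ∀ᶠ q' in 𝓝[≠] q, X q' ≠ 0 := by
  have hqt := (chartAt E p₀).map_source hq
  have h1 := (((coords_contDiffOn p₀ X).contDiffAt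
    ((chartAt E p₀).open_target.mem_nhds hqt)).differentiableAt (by simp)).hasFDerivAt
  have h2 := ContinuousLinearEquiv.antilipschitz
    (ContinuousLinearMap.toContinuousLinearEquivOfDetNeZero _ hdet)
  have h3 : ∀ᶠ x in 𝓝[≠] (chartAt E p₀ q), coords p₀ X x ≠ 0 :=
    h1.eventually_ne ⟨_, h2⟩
  have h4 : Filter.Tendsto (chartAt E p₀) (𝓝[≠] q) (𝓝[≠] (chartAt E p₀ q)) := by
    refine tendsto_nhdsWithin_iff.2 ⟨((chartAt E p₀).continuousAt hq).mono_left
      nhdsWithin_le_nhds, ?_⟩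
    filter_upwards [self_mem_nhdsWithin,
      mem_nhdsWithin_of_mem_nhds ((chartAt E p₀).open_source.mem_nhds hq)] with z hz hzs h
    exact hz ((chartAt E p₀).injOn hzs hq h)
  filter_upwards [h4.eventually h3,
    mem_nhdsWithin_of_mem_nhds ((chartAt E p₀).open_source.mem_nhds hq)] with z hz hzs h
  exact hz ((coords_eq_zero_iff p₀ X hzs).2 h)

/-- Generically, the equilibria near a given point are isolated. -/
theorem exists_residual_isolated [FiniteDimensional ℝ E] [T2Space M]
    (p₀ : M) :
    ∃ U ∈ 𝓝 p₀, ∀ᶠ X in residual (SmoothVectorField E M), ∀ q ∈ U, X q = 0 →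
      ∀ᶠ q' in 𝓝[≠] q, X q' ≠ 0 := by
  obtain ⟨ε', hε', hb⟩ := Metric.isOpen_iff.1 (chartAt E p₀).open_target _
    (mem_chart_target E p₀)
  obtain ⟨ε, hε, hεt⟩ : ∃ ε > 0,
      Metric.closedBall (chartAt E p₀ p₀) (2 * ε) ⊆ (chartAt E p₀).target :=
    ⟨ε' / 4, by positivity, (Metric.closedBall_subset_ball (by linarith)).trans hb⟩
  let K := Metric.closedBall (chartAt E p₀ p₀) (ε / 2)
  have hKB : K ⊆ Metric.ball (chartAt E p₀ p₀) ε := Metric.closedBall_subset_ball (by linarith)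
  have hKt : K ⊆ (chartAt E p₀).target :=
    (Metric.closedBall_subset_closedBall (by linarith)).trans hεt
  refine ⟨(chartAt E p₀).source ∩ chartAt E p₀ ⁻¹' K, ?_, ?_⟩
  · refine Filter.inter_mem (chart_source_mem_nhds E p₀) ?_
    exact ((chartAt E p₀).continuousAt (mem_chart_source E p₀)).preimage_mem_nhds
      (Metric.closedBall_mem_nhds _ (by positivity))
  · have hdense : Dense {X : SmoothVectorField E M | ∀ x ∈ K, coords p₀ X x = 0 →
        (fderiv ℝ (coords p₀ X) x).det ≠ 0} := by
      refine (dense_nondegenerate p₀ hε hεt).mono ?_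
      exact fun X hX x hx => hX x (hKB hx)
    have hres := residual_of_dense_open
      (isOpen_nondegenerate p₀ (isCompact_closedBall _ _) hKt) hdense
    filter_upwards [hres] with X hX q hq hXq
    exact eventually_ne_zero_of_nondegenerate p₀ X hq.1
      (hX _ hq.2 ((coords_eq_zero_iff p₀ X hq.1).2 hXq))

end Equilibria

/-! ### Curves in level sets and high-order tangency -/

section LevelSets

variable {E : Type*} [NormedAddCommGroup E] [NormedSpace ℝ E]

/-- Near a regular point of `g` there are a smooth extension `α` of the differential of `g` and a
compactly supported smooth vector field `N` along which `g` has derivative `1`. -/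
theorem exists_transverse_field [FiniteDimensional ℝ E] {g : E → ℝ} {Ω : Set E} (hΩ : IsOpen Ω)
    (hg : ContDiffOn ℝ ∞ g Ω) {x₀ : E} (hx₀ : x₀ ∈ Ω) (hd : fderiv ℝ g x₀ ≠ 0) :
    ∃ (α : E → E →L[ℝ] ℝ) (N : E → E) (ε : ℝ) (K : Set E), ContDiff ℝ ∞ α ∧ ContDiff ℝ ∞ N ∧
      0 < ε ∧ IsCompact K ∧ K ⊆ Ω ∧ Metric.ball x₀ ε ⊆ K ∧ (∀ x ∉ K, N x = 0) ∧
      ∀ x ∈ Metric.ball x₀ ε, α x = fderiv ℝ g x ∧ α x (N x) = 1 := by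
  obtain ⟨v, hv⟩ : ∃ v, fderiv ℝ g x₀ v ≠ 0 := by
    by_contra! h
    exact hd (ContinuousLinearMap.ext h)
  have hdg : ContDiffOn ℝ ∞ (fderiv ℝ g) Ω := hg.fderiv_of_isOpen hΩ (by simp)
  have hdgv : ContDiffOn ℝ ∞ (fun x => fderiv ℝ g x v) Ω := hdg.clm_apply contDiffOn_const
  let Ω' : Set E := Ω ∩ (fun x => fderiv ℝ g x v) ⁻¹' {0}ᶜ
  have hΩ' : IsOpen Ω' := hdgv.continuousOn.isOpen_inter_preimage hΩ isOpen_compl_singleton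
  obtain ⟨η, hη, hb⟩ := Metric.isOpen_iff.1 hΩ' x₀ ⟨hx₀, hv⟩
  let χ : ContDiffBump x₀ := ⟨η / 4, η / 2, by positivity, by linarith⟩
  have hKΩ' : Metric.closedBall x₀ (η / 2) ⊆ Ω' :=
    (Metric.closedBall_subset_ball (by linarith)).trans hb
  have hsupp : tsupport χ ⊆ Ω' := by rw [χ.tsupport_eq]; exact hKΩ'
  refine ⟨fun x => χ x • fderiv ℝ g x, fun x => χ x • ((fderiv ℝ g x v)⁻¹ • v), η / 4,
    Metric.closedBall x₀ (η / 2), ?_, ?_, by positivity, isCompact_closedBall _ _,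
    hKΩ'.trans Set.inter_subset_left, ?_, fun x hx => ?_, fun x hx => ?_⟩
  · exact contDiff_smul_of_tsupport hΩ' χ.contDiff (hdg.mono Set.inter_subset_left) hsupp
  · refine contDiff_smul_of_tsupport hΩ' χ.contDiff ?_ hsupp
    exact ((hdgv.mono Set.inter_subset_left).inv fun x hx => hx.2).smul contDiffOn_const
  · exact Metric.ball_subset_closedBall.trans (Metric.closedBall_subset_closedBall (by linarith))
  · have : χ x = 0 := χ.zero_of_le_dist (by
      simp only [Metric.mem_closedBall, not_le] at hx; exact hx.le)
    simp [this]
  · have h1 : χ x = 1 := χ.one_of_mem_closedBall (Metric.ball_subset_closedBall hx)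
    have h2 : fderiv ℝ g x v ≠ 0 :=
      (hb (Metric.ball_subset_ball (by linarith) hx)).2
    simp [h1, h2]

/-- The component of a vector `z.2` at `z.1` which is tangent to the kernel of `α`. -/
def tangentPart (α : E → E →L[ℝ] ℝ) (N : E → E) (z : E × E) : E := z.2 - α z.1 z.2 • N z.1

/-- The tangential component, rescaled by a function of its coordinate `y`. -/
def scaledTangentPart (α : E → E →L[ℝ] ℝ) (N : E → E) (y : E →L[ℝ] ℝ) (ρ : ℝ → ℝ) (z : E × E) :
    E := ρ (y (tangentPart α N z)) • tangentPart α N z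

/-- The component of a vector `z.2` at `z.1` which is normal to the kernel of `α`. -/
def normalPart (α : E → E →L[ℝ] ℝ) (z : E × E) : ℝ := α z.1 z.2

variable {α : E → E →L[ℝ] ℝ} {N : E → E} {y : E →L[ℝ] ℝ} {ρ : ℝ → ℝ}

theorem contDiff_normalPart (hα : ContDiff ℝ ∞ α) : ContDiff ℝ ∞ (normalPart α) :=
  (hα.comp contDiff_fst).clm_apply contDiff_snd

theorem contDiff_tangentPart (hα : ContDiff ℝ ∞ α) (hN : ContDiff ℝ ∞ N) :
    ContDiff ℝ ∞ (tangentPart α N) :=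
  contDiff_snd.sub ((contDiff_normalPart hα).smul (hN.comp contDiff_fst))

theorem contDiff_scaledTangentPart (hα : ContDiff ℝ ∞ α) (hN : ContDiff ℝ ∞ N)
    (hρ : ContDiff ℝ ∞ ρ) : ContDiff ℝ ∞ (scaledTangentPart α N y ρ) :=
  (hρ.comp (y.contDiff.comp (contDiff_tangentPart hα hN))).smul (contDiff_tangentPart hα hN)

/-- Perturbing along N therefore alters the differentiated function but not the direction of
differentiation, so the tangency equations become affine in the perturbation. -/
theorem tangentPart_add_smul {x : E} (h : α x (N x) = 1) (ξ : E) (s : ℝ) :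
    tangentPart α N (x, ξ + s • N x) = tangentPart α N (x, ξ) := by
  simp only [tangentPart, map_add, map_smul, h, smul_eq_mul, mul_one, add_smul]
  abel

theorem normalPart_add_smul {x : E} (h : α x (N x) = 1) (ξ : E) (s : ℝ) :
    normalPart α (x, ξ + s • N x) = normalPart α (x, ξ) + s := by
  simp [normalPart, h]

/-- A map `u : E → E × E`, thought of as a vector field, is tangent at `x` to a high order to the
level sets of the function with differential `α`. -/
def IsHighlyTangent (α : E → E →L[ℝ] ℝ) (N : E → E) (y : E →L[ℝ] ℝ) (ρ : ℝ → ℝ) (δ : ℝ)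
    (u : E → E × E) (x : E) : Prop :=
  2 * δ ≤ |y (tangentPart α N (u x))| ∧ ∀ j ≤ Module.finrank ℝ E,
    iterLie (scaledTangentPart α N y ρ ∘ u) (normalPart α ∘ u) j x = 0

/-- A curve in a level set of `g` which solves a differential equation is highly tangent. -/
theorem isHighlyTangent_of_curve {g : E → ℝ} {B : Set E} (hB : IsOpen B)
    (hα : ContDiff ℝ ∞ α) (hN : ContDiff ℝ ∞ N) (hρ : ContDiff ℝ ∞ ρ)
    (hg : DifferentiableOn ℝ g B) (hαg : ∀ x ∈ B, α x = fderiv ℝ g x)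
    {ξ : E → E} (hξ : ContDiffOn ℝ ∞ ξ B) {u : E → E × E} (hu : ∀ x ∈ B, u x = (x, ξ x))
    {σ : ℝ → E} {t₀ : ℝ} (hσ : ∀ᶠ t in 𝓝 t₀, HasDerivAt σ (ξ (σ t)) t) (hσB : σ t₀ ∈ B)
    (hgσ : ∀ᶠ t in 𝓝 t₀, g (σ t) = g (σ t₀)) {δ : ℝ} (hδ : 2 * δ ≤ |y (ξ (σ t₀))|) :
    IsHighlyTangent α N y ρ δ u (σ t₀) := by
  have huB : ContDiffOn ℝ ∞ u B := (contDiffOn_id.prodMk hξ).congr hu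
  have hσB' : ∀ᶠ t in 𝓝 t₀, σ t ∈ B :=
    hσ.self_of_nhds.continuousAt.eventually (hB.mem_nhds hσB)
  obtain ⟨T, hT, hTo, ht₀⟩ := eventually_nhds_iff.1 (hσ.and (hσB'.and hgσ))
  have hn : ∀ t ∈ T, normalPart α (u (σ t)) = 0 := by
    intro t ht
    obtain ⟨h1, h2, -⟩ := hT t ht
    have h3 := ((hg.differentiableAt (hB.mem_nhds h2)).hasFDerivAt.comp_hasDerivAt t h1)
    have h4 : g ∘ σ =ᶠ[𝓝 t] fun _ => g (σ t₀) :=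
      Filter.eventuallyEq_of_mem (hTo.mem_nhds ht) fun s hs => (hT s hs).2.2
    have h5 := h3.unique ((hasDerivAt_const t (g (σ t₀))).congr_of_eventuallyEq h4)
    rw [hu _ h2, normalPart, hαg _ h2, h5]
  have htan : ∀ t ∈ T, tangentPart α N (u (σ t)) = ξ (σ t) := by
    intro t ht
    have h1 := hn t ht
    rw [hu _ (hT t ht).2.1] at h1 ⊢
    simp only [normalPart] at h1
    simp [tangentPart, h1]
  have hl : ∀ j, ∀ t ∈ T,
      iterLie (scaledTangentPart α N y ρ ∘ u) (normalPart α ∘ u) j (σ t) = 0 := by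
    intro j
    induction j with
    | zero => exact hn
    | succ j ih =>
      intro t ht
      obtain ⟨h1, h2, -⟩ := hT t ht
      have h3 := iterLie_contDiffOn hB
        ((contDiff_scaledTangentPart (y := y) hα hN hρ).comp_contDiffOn huB)
        ((contDiff_normalPart hα).comp_contDiffOn huB) j
      have h4 := ((h3.contDiffAt (hB.mem_nhds h2)).differentiableAt
        (by simp)).hasFDerivAt.comp_hasDerivAt t h1
      have h5 : iterLie (scaledTangentPart α N y ρ ∘ u) (normalPart α ∘ u) j ∘ σ
          =ᶠ[𝓝 t] fun _ => 0 :=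
        Filter.eventuallyEq_of_mem (hTo.mem_nhds ht) ih
      have h6 := h4.unique ((hasDerivAt_const t (0 : ℝ)).congr_of_eventuallyEq h5)
      -- On the curve the scaled field is a multiple of the velocity, so differentiating along it
      -- again gives 0.
      simp only [iterLie, Function.comp_apply, scaledTangentPart, htan t ht, map_smul]
      rw [smul_eq_mul]
      exact mul_eq_zero_of_right _ h6
  exact ⟨by rwa [htan t₀ ht₀], fun j _ => hl j t₀ ht₀⟩

variable {M : Type*} [TopologicalSpace M] [ChartedSpace E M] [IsManifold 𝓘(ℝ, E) ∞ M]

theorem isOpen_not_isHighlyTangent (p₀ : M) {K : Set E} (hK : IsCompact K)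
    (hKt : K ⊆ (chartAt E p₀).target) (hα : ContDiff ℝ ∞ α) (hN : ContDiff ℝ ∞ N)
    (hρ : ContDiff ℝ ∞ ρ) (δ : ℝ) :
    IsOpen {X : SmoothVectorField E M |
      ∀ x ∈ K, ¬ IsHighlyTangent α N y ρ δ (localRep p₀ X) x} := by
  set n := Module.finrank ℝ E with hn
  -- The local representative retains the base point, so both parts are fixed smooth functions of
  -- its value.
  choose Ψ hΨ hΨj using exists_iterLie_eq_jet (contDiff_normalPart hα)
    (contDiff_scaledTangentPart (y := y) hα hN hρ)
  let R : ∀ j ≤ n, JetSpace n E (E × E) → JetSpace j E (E × E) := fun j hj J k =>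
    J ⟨k, by omega⟩
  have hR : ∀ j hj, Continuous (R j hj) := fun j hj =>
    continuous_pi fun k => (contDiff_jetSpace_apply n ⟨k, by omega⟩).continuous
  let O : Set (JetSpace n E (E × E)) :=
    {J | 2 * δ ≤ |y (tangentPart α N (J ⟨0, n.succ_pos⟩ 0))| ∧
      ∀ j, ∀ hj : j ≤ n, Ψ j (R j hj J) = 0}ᶜ
  have hO : IsOpen O := by
    refine IsClosed.isOpen_compl (self := IsClosed.inter ?_ ?_)
    · exact isClosed_le continuous_const (y.continuous.comp
        ((contDiff_tangentPart hα hN).continuous.comp (contDiff_jetSpace_value n).continuous)).abs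
    · have : {J | ∀ j, ∀ hj : j ≤ n, Ψ j (R j hj J) = 0} =
          ⋂ j, ⋂ hj : j ≤ n, {J | Ψ j (R j hj J) = 0} := by
        ext J; simp
      change IsClosed {J | ∀ j, ∀ hj : j ≤ n, Ψ j (R j hj J) = 0}
      rw [this]
      exact isClosed_iInter fun j => isClosed_iInter fun hj =>
        isClosed_eq ((hΨ j).continuous.comp (hR j hj)) continuous_const
  convert isOpen_forall_jet_mem p₀ hK hKt n hO using 1
  ext X
  refine forall₂_congr fun x hx => not_congr (and_congr ?_ (forall₂_congr fun j hj => ?_))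
  · simp [jet]
  · rw [hΨj j _ _ (chartAt E p₀).open_target (localRep_contDiffOn p₀ X) x (hKt hx)]
    rfl

theorem dense_not_isHighlyTangent [FiniteDimensional ℝ E] [T2Space M] (p₀ : M) {B K : Set E} (hB : IsOpen B)
    (hBK : B ⊆ K) (hK : IsCompact K) (hKt : K ⊆ (chartAt E p₀).target) (hα : ContDiff ℝ ∞ α)
    (hN : ContDiff ℝ ∞ N) (hNK : ∀ x ∉ K, N x = 0) (hαN : ∀ x ∈ B, α x (N x) = 1)
    (hρ : ContDiff ℝ ∞ ρ) {δ : ℝ} (hδ : 0 < δ) (hρδ : ∀ t, δ ≤ |t| → ρ t * t = 1) :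
    Dense {X : SmoothVectorField E M |
      ∀ x ∈ B, ¬ IsHighlyTangent α N y ρ δ (localRep p₀ X) x} := by
  refine dense_of_dense_perturb fun X => ?_
  set n := Module.finrank ℝ E with hn
  obtain ⟨W, hc, hW⟩ := exists_continuous_perturb p₀ X
    (w := fun (a : Fin (n + 1)) x => (y x) ^ (a : ℕ) • N x)
    (fun a => (y.contDiff.pow _).smul hN) hK hKt (fun a x hx => by simp [hNK x hx])
  refine ⟨_, W, hc, ?_⟩
  have hBt := hBK.trans hKt
  let u := localRep p₀ X
  have hu : ContDiffOn ℝ ∞ u B := (localRep_contDiffOn p₀ X).mono hBt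
  -- Tangency requires speed at least 2δ, a closed condition. The open set where the speed exceeds δ
  -- contains all such points of B, and on it `ρ` gives y-speed exactly 1.
  let O : Set E := B ∩ (fun x => |y (tangentPart α N (u x))|) ⁻¹' Set.Ioi δ
  have htc : ContinuousOn (fun x => |y (tangentPart α N (u x))|) B :=
    (y.continuous.comp_continuousOn
      ((contDiff_tangentPart hα hN).continuous.comp_continuousOn hu.continuousOn)).abs
  have hO : IsOpen O := htc.isOpen_inter_preimage hB isOpen_Ioi
  have hOB : O ⊆ B := Set.inter_subset_left
  have hd := dense_perturbation (n := n) (y := y) hO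
    ((contDiff_scaledTangentPart (y := y) hα hN hρ).comp_contDiffOn (hu.mono hOB))
    ((contDiff_normalPart hα).comp_contDiffOn (hu.mono hOB))
    (fun x hx => by
      simp only [Function.comp_apply, scaledTangentPart, map_smul, smul_eq_mul]
      exact hρδ _ (le_of_lt hx.2)) hn.ge
  refine hd.mono fun c hcd x hx hbad => ?_
  have hrep : ∀ z ∈ B, localRep p₀ (perturb X W c) z =
      (z, coords p₀ X z + (coeffPoly c).eval (y z) • N z) := by
    intro z hz
    rw [localRep_eq p₀ _ (hBt hz), hW c z (hBt hz)]
    simp [coeffPoly, Polynomial.eval_finsetSum, Finset.sum_smul, mul_smul]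
  have hrep0 : ∀ z ∈ B, u z = (z, coords p₀ X z) := fun z hz => localRep_eq p₀ _ (hBt hz)
  have htan : ∀ z ∈ B, tangentPart α N (localRep p₀ (perturb X W c) z) =
      tangentPart α N (u z) := fun z hz => by
    rw [hrep z hz, hrep0 z hz, tangentPart_add_smul (hαN z hz)]
  have hxO : x ∈ O := by
    refine ⟨hx, ?_⟩
    have := hbad.1
    rw [htan x hx] at this
    change δ < _
    linarith
  obtain ⟨j, hj, hne⟩ := hcd x hxO
  refine hne ?_
  rw [← hbad.2 j hj]
  refine (iterLie_congr hO (fun z hz => ?_) (fun z hz => ?_) j hxO).symm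
  · simp only [Function.comp_apply, scaledTangentPart, htan z (hOB hz)]
  · simp only [Function.comp_apply, Pi.add_apply]
    rw [hrep z (hOB hz), normalPart_add_smul (hαN z (hOB hz)), hrep0 z (hOB hz)]

/-- Generically, no nonconstant solution near a regular point of `G` lies in a level set of `G`. -/
theorem exists_residual_not_tangent [FiniteDimensional ℝ E] [T2Space M] {G : M → ℝ} {U : Set M} (hU : IsOpen U)
    (hG : ContMDiffOn 𝓘(ℝ, E) 𝓘(ℝ, ℝ) ∞ G U) {p₀ : M} (hp₀ : p₀ ∈ U)
    (hd : mfderiv 𝓘(ℝ, E) 𝓘(ℝ, ℝ) G p₀ ≠ 0) :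
    ∃ V ∈ 𝓝 p₀, ∀ᶠ X : SmoothVectorField E M in residual _, ∀ (γ : ℝ → M) (s : Set ℝ), IsOpen s →
      IsMIntegralCurveOn γ X s → ∀ t ∈ s, γ t ∈ V → X (γ t) ≠ 0 →
        ¬ ∀ᶠ t' in 𝓝 t, G (γ t') = G (γ t) := by
  let φ := chartAt E p₀
  let g : E → ℝ := G ∘ φ.symm
  let Ω : Set E := φ.target ∩ φ.symm ⁻¹' U
  have hΩ : IsOpen Ω := φ.continuousOn_symm.isOpen_inter_preimage φ.open_target hU
  have hφs := contMDiffOn_symm_of_mem_maximalAtlas (I := 𝓘(ℝ, E)) (n := ∞)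
    (IsManifold.chart_mem_maximalAtlas (I := 𝓘(ℝ, E)) p₀)
  have hg : ContDiffOn ℝ ∞ g Ω := by
    rw [← contMDiffOn_iff_contDiffOn]
    exact hG.comp (hφs.mono Set.inter_subset_left) fun z hz => hz.2
  have hx₀ : φ p₀ ∈ Ω := ⟨mem_chart_target E p₀, by
    change φ.symm (φ p₀) ∈ U
    rwa [φ.left_inv (mem_chart_source E p₀)]⟩
  have hdg : fderiv ℝ g (φ p₀) ≠ 0 := by
    intro h0
    apply hd
    have h1 : MDifferentiableAt 𝓘(ℝ, E) 𝓘(ℝ, ℝ) g (φ p₀) :=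
      ((hg.contDiffAt (hΩ.mem_nhds hx₀)).differentiableAt (by simp)).mdifferentiableAt
    have h2 := h1.hasMFDerivAt.comp p₀ (mdifferentiableAt_atlas (I := 𝓘(ℝ, E))
      (chart_mem_atlas E p₀) (mem_chart_source E p₀)).hasMFDerivAt
    have h3 : G =ᶠ[𝓝 p₀] g ∘ φ := by
      filter_upwards [chart_source_mem_nhds E p₀] with q hq
      simp only [g, Function.comp_apply]
      rw [φ.left_inv hq]
    rw [h3.mfderiv_eq, h2.mfderiv, mfderiv_eq_fderiv, h0]
    exact ContinuousLinearMap.zero_comp _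
  obtain ⟨α, N, ε, K, hα, hN, hε, hK, hKΩ, hBK, hNK, hαN⟩ :=
    exists_transverse_field hΩ hg hx₀ hdg
  have hKt : K ⊆ φ.target := hKΩ.trans Set.inter_subset_left
  let K' := Metric.closedBall (φ p₀) (ε / 2)
  have hK'B : K' ⊆ Metric.ball (φ p₀) ε := Metric.closedBall_subset_ball (by linarith)
  let b := Module.finBasis ℝ E
  let y : Fin (Module.finrank ℝ E) → E →L[ℝ] ℝ := fun i => (b.coord i).toContinuousLinearMap
  -- The condition T ≠ 0 is not closed. It is exhausted by countably many closed conditions, one for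
  -- each coordinate and each threshold 1/(m + 1).
  choose ρ hρ hρδ using fun m : ℕ => exists_smooth_inv (δ := 1 / ((m : ℝ) + 1)) (by positivity)
  have hres : ∀ᶠ X in residual (SmoothVectorField E M), ∀ i, ∀ m : ℕ, ∀ x ∈ K',
      ¬ IsHighlyTangent α N (y i) (ρ m) (1 / ((m : ℝ) + 1)) (localRep p₀ X) x := by
    rw [Filter.eventually_all]
    intro i
    rw [eventually_countable_forall]
    intro m
    refine residual_of_dense_open
      (isOpen_not_isHighlyTangent p₀ (isCompact_closedBall _ _) ((hK'B.trans hBK).trans hKt)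
        hα hN (hρ m) _) ?_
    refine (dense_not_isHighlyTangent (y := y i) p₀ Metric.isOpen_ball hBK hK hKt hα hN hNK
      (fun x hx => (hαN x hx).2) (hρ m) (by positivity) (hρδ m)).mono ?_
    exact fun X hX x hx => hX x (hK'B hx)
  refine ⟨φ.source ∩ φ ⁻¹' K', ?_, ?_⟩
  · refine Filter.inter_mem (chart_source_mem_nhds E p₀) ?_
    exact (φ.continuousAt (mem_chart_source E p₀)).preimage_mem_nhds
      (Metric.closedBall_mem_nhds _ (by positivity))
  filter_upwards [hres] with X hX γ s hs hγ t ht hγt hXt hGt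
  have hξ : coords p₀ X (φ (γ t)) ≠ 0 := fun h =>
    hXt ((coords_eq_zero_iff p₀ X hγt.1).1 h)
  obtain ⟨i, hi⟩ : ∃ i, y i (coords p₀ X (φ (γ t))) ≠ 0 := by
    by_contra! h
    exact hξ (b.forall_coord_eq_zero_iff.1 h)
  obtain ⟨m, hm⟩ := exists_nat_one_div_lt (half_pos (abs_pos.2 hi))
  have hγc : ContinuousAt γ t := (hγ.continuousOn t ht).continuousAt (hs.mem_nhds ht)
  have hsrc : ∀ᶠ t' in 𝓝 t, γ t' ∈ φ.source :=
    hγc.eventually (φ.open_source.mem_nhds hγt.1)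
  refine hX i m (φ (γ t)) hγt.2 ?_
  have hBt := (hBK.trans hKt)
  refine isHighlyTangent_of_curve (g := g) (B := Metric.ball (φ p₀) ε) (ξ := coords p₀ X)
    (σ := φ ∘ γ) Metric.isOpen_ball hα hN (hρ m)
    ((hg.mono (hBK.trans hKΩ)).differentiableOn (by simp)) (fun x hx => (hαN x hx).1)
    ((coords_contDiffOn p₀ X).mono hBt) (fun x hx => localRep_eq p₀ X (hBt hx)) ?_
    (hK'B hγt.2) ?_ ?_
  · filter_upwards [hsrc, hs.mem_nhds ht] with t' h1 h2
    exact hasDerivAt_chart_comp p₀ X hs hγ h2 h1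
  · filter_upwards [hsrc, hGt] with t' h1 h2
    simp only [g, Function.comp_apply]
    rw [φ.left_inv h1, φ.left_inv hγt.1, h2]
  · simp only [Function.comp_apply]
    linarith

end LevelSets

/-! ### Globalisation and the main theorem -/

/-- Near each of its points, a submanifold of codimension one lies in a regular level set. -/
theorem IsSubmanifoldOfCodim.exists_defining_function {E : Type*} [NormedAddCommGroup E]
    [NormedSpace ℝ E] [FiniteDimensional ℝ E] {M : Type*} [TopologicalSpace M] [ChartedSpace E M]
    {Z : Set M} (hZ : IsSubmanifoldOfCodim (E := E) 1 Z) {p : M} (hp : p ∈ Z) :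
    ∃ (G : M → ℝ) (U : Set M), IsOpen U ∧ p ∈ U ∧ ContMDiffOn 𝓘(ℝ, E) 𝓘(ℝ, ℝ) ∞ G U ∧
      mfderiv 𝓘(ℝ, E) 𝓘(ℝ, ℝ) G p ≠ 0 ∧ ∀ q ∈ U, q ∈ Z → G q = 0 := by
  obtain ⟨φ, hφ, W, hW, hpφ, hφW⟩ := hZ p hp
  -- Codimension 1 makes W proper, so a nonzero linear functional vanishes on it. Its pullback by
  -- the chart is the defining function.
  have hWtop : W < ⊤ := lt_top_iff_ne_top.2 fun h => by
    rw [h, finrank_top] at hW; omega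
  obtain ⟨l, hl0, hlW⟩ := W.exists_le_ker_of_lt_top hWtop
  let l' : E →L[ℝ] ℝ := l.toContinuousLinearMap
  have hφs := contMDiffOn_of_mem_maximalAtlas hφ
  refine ⟨l' ∘ φ, φ.source, φ.open_source, hpφ,
    l'.contDiff.contMDiff.comp_contMDiffOn hφs, fun h => hl0 ?_, fun q hq hqZ =>
      hlW ((hφW q hq).1 hqZ)⟩
  have h1 : MDifferentiableAt 𝓘(ℝ, E) 𝓘(ℝ, ℝ) (l' ∘ φ) (φ.symm (φ p)) := by
    rw [φ.left_inv hpφ]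
    exact ((l'.contDiff.contMDiff.comp_contMDiffOn hφs).contMDiffAt
      (φ.open_source.mem_nhds hpφ)).mdifferentiableAt (by simp)
  have h2 : MDifferentiableAt 𝓘(ℝ, E) 𝓘(ℝ, E) φ.symm (φ p) :=
    ((contMDiffOn_symm_of_mem_maximalAtlas hφ).contMDiffAt
      (φ.open_target.mem_nhds (φ.map_source hpφ))).mdifferentiableAt (by simp)
  have h3 := h1.hasMFDerivAt.comp (φ p) h2.hasMFDerivAt
  have h4 : l' =ᶠ[𝓝 (φ p)] (l' ∘ φ) ∘ φ.symm := by
    filter_upwards [φ.open_target.mem_nhds (φ.map_source hpφ)] with x hx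
    simp only [Function.comp_apply]
    rw [φ.right_inv hx]
  have h5 : fderiv ℝ l' (φ p) = 0 := by
    rw [← mfderiv_eq_fderiv, h4.mfderiv_eq, h3.mfderiv, φ.left_inv hpφ, h]
    exact ContinuousLinearMap.zero_comp _
  rw [l'.fderiv] at h5
  ext v
  exact DFunLike.congr_fun h5 v

/-- By second countability, countably many of the neighbourhoods cover S, and the filter is closed
under countable intersections. -/
theorem eventually_forall_mem_of_local {M Y : Type*} [TopologicalSpace M]
    [SecondCountableTopology M] {l : Filter Y} [CountableInterFilter l] {S : Set M}
    {Q : M → Y → Prop} (h : ∀ p ∈ S, ∃ V ∈ 𝓝 p, ∀ᶠ X in l, ∀ q ∈ V, Q q X) :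
    ∀ᶠ X in l, ∀ q ∈ S, Q q X := by
  choose! V hV hQ using h
  obtain ⟨t, htS, htc, hcov⟩ := TopologicalSpace.countable_cover_nhdsWithin
    (s := S) fun p hp => mem_nhdsWithin_of_mem_nhds (hV p hp)
  have h1 : ∀ᶠ X in l, ∀ p ∈ t, ∀ q ∈ V p, Q q X :=
    (eventually_countable_ball htc).2 fun p hp => hQ p (htS hp)
  filter_upwards [h1] with X hX q hq
  obtain ⟨p, hp, hqp⟩ := Set.mem_iUnion₂.1 (hcov hq)
  exact hX p hp q hqp

theorem eventually_vectorField_ne_zero {E : Type*} [NormedAddCommGroup E] [NormedSpace ℝ E]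
    {M : Type*} [TopologicalSpace M] [ChartedSpace E M] [IsManifold 𝓘(ℝ, E) ∞ M]
    (X : SmoothVectorField E M) {p : M} (hp : X p ≠ 0) : ∀ᶠ q in 𝓝 p, X q ≠ 0 := by
  have hs := mem_chart_source E p
  have h1 : ContinuousAt (coords p X ∘ chartAt E p) p :=
    (((coords_contDiffOn p X).continuousOn.continuousAt
      ((chartAt E p).open_target.mem_nhds (mem_chart_target E p)))).comp
      ((chartAt E p).continuousAt hs)
  have h2 : (coords p X ∘ chartAt E p) p ≠ 0 := fun h => hp ((coords_eq_zero_iff p X hs).1 h)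
  filter_upwards [h1.eventually_ne h2, chart_source_mem_nhds E p] with q hq hqs h
  exact hq ((coords_eq_zero_iff p X hqs).2 h)

theorem mainTheorem2 {n : ℕ} {P : Type*} [TopologicalSpace P] [T2Space P]
    [SecondCountableTopology P] [ChartedSpace (EuclideanSpace ℝ (Fin n)) P]
    [IsManifold (𝓡 n) ∞ P] (F : P → ℝ) (hF : ContMDiff (𝓡 n) 𝓘(ℝ, ℝ) ∞ F) (Z : Set P)
    (hZ : IsSubmanifoldOfCodim (E := EuclideanSpace ℝ (Fin n)) 1 Z)
    (hcrit : {p : P | mfderiv (𝓡 n) 𝓘(ℝ, ℝ) F p = 0} ⊆ Z) :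
    ∃ C ∈ residual (SmoothVectorField (EuclideanSpace ℝ (Fin n)) P), ∀ X ∈ C,
      (¬ ∃ (γ : ℝ → P) (s : Set ℝ), IsOpen s ∧ s.OrdConnected ∧ IsMIntegralCurveOn γ X s ∧
        (∃ t ∈ s, X (γ t) ≠ 0) ∧ ∃ c : ℝ, ∀ t ∈ s, F (γ t) = c) ∧
      ∀ p : P, X p = 0 → ∀ᶠ q in 𝓝[≠] p, X q ≠ 0 := by
  have hA : ∀ᶠ X : SmoothVectorField (EuclideanSpace ℝ (Fin n)) P in residual _,
      ∀ q ∈ {p : P | mfderiv (𝓡 n) 𝓘(ℝ, ℝ) F p = 0}ᶜ, ∀ (γ : ℝ → P) (s : Set ℝ), IsOpen s →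
        IsMIntegralCurveOn γ X s → ∀ t ∈ s, γ t = q → X (γ t) ≠ 0 →
          ¬ ∀ᶠ t' in 𝓝 t, F (γ t') = F (γ t) := by
    refine eventually_forall_mem_of_local fun p hp => ?_
    obtain ⟨V, hV, h⟩ := exists_residual_not_tangent isOpen_univ hF.contMDiffOn
      (Set.mem_univ p) hp
    refine ⟨V, hV, h.mono ?_⟩
    rintro X hX _ hq γ s hs hγ t ht rfl
    exact hX γ s hs hγ t ht hq
  have hB : ∀ᶠ X : SmoothVectorField (EuclideanSpace ℝ (Fin n)) P in residual _,
      ∀ q ∈ Z, ∀ (γ : ℝ → P) (s : Set ℝ), IsOpen s →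
        IsMIntegralCurveOn γ X s → ∀ t ∈ s, γ t = q → X (γ t) ≠ 0 →
          ¬ ∀ᶠ t' in 𝓝 t, γ t' ∈ Z := by
    refine eventually_forall_mem_of_local fun p hp => ?_
    obtain ⟨G, U, hU, hpU, hG, hdG, hGZ⟩ := hZ.exists_defining_function hp
    obtain ⟨V, hV, h⟩ := exists_residual_not_tangent hU hG hpU hdG
    refine ⟨V ∩ U, Filter.inter_mem hV (hU.mem_nhds hpU), h.mono ?_⟩
    rintro X hX _ hq γ s hs hγ t ht rfl hXt hγZ
    refine hX γ s hs hγ t ht hq.1 hXt ?_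
    have hγc : ContinuousAt γ t := (hγ.continuousOn t ht).continuousAt (hs.mem_nhds ht)
    filter_upwards [hγZ, hγc.eventually (hU.mem_nhds hq.2)] with t' h1 h2
    rw [hGZ _ h2 h1, hGZ _ hq.2 hγZ.self_of_nhds]
  have hC : ∀ᶠ X : SmoothVectorField (EuclideanSpace ℝ (Fin n)) P in residual _,
      ∀ p ∈ Set.univ, X p = 0 → ∀ᶠ q in 𝓝[≠] p, X q ≠ 0 :=
    eventually_forall_mem_of_local fun p _ => exists_residual_isolated p
  refine ⟨_, hA.and (hB.and hC), ?_⟩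
  rintro X ⟨hXA, hXB, hXC⟩
  refine ⟨?_, fun p => hXC p trivial⟩
  rintro ⟨γ, s, hs, -, hγ, ⟨t, ht, hXt⟩, c, hFc⟩
  have hγc : ContinuousAt γ t := (hγ.continuousOn t ht).continuousAt (hs.mem_nhds ht)
  -- X stays nonzero at nearby times, so a regular point of F on this piece of the curve would
  -- contradict `hXA`.
  have hcr : ∀ᶠ t' in 𝓝 t, mfderiv (𝓡 n) 𝓘(ℝ, ℝ) F (γ t') = 0 := by
    filter_upwards [hs.mem_nhds ht,
      hγc.eventually (eventually_vectorField_ne_zero X hXt)] with t' ht' hX'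
    by_contra hne
    refine hXA _ hne γ s hs hγ t' ht' rfl hX' ?_
    filter_upwards [hs.mem_nhds ht'] with r hr
    rw [hFc r hr, hFc t' ht']
  exact hXB (γ t) (hcrit hcr.self_of_nhds) γ s hs hγ t ht rfl hXt (hcr.mono fun _ h => hcrit h)
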